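/- Let $K\ge 1$ be the number of classes, let $n_1,\dots,n_K\ge 1$ be the class sizes, $N=\sum_k n_k$, and let $\lambda_Z,\lambda_b>0$. Index the columns of $K\times N$ matrices by pairs $(k,i)$ with $1\le k\le K$, $1\le i\le n_k$, and let $Y\in\mathbb{R}^{K\times N}$ be the matrix whose column $(k,i)$ is the standard basis vector $e_k$. Put $D=YY^\top=\mathrm{diag}(n_1,\dots,n_K)$ and $\ell_{CE}(z,e_k)=\log\sum_{l=1}^K e^{z_l}-z_k$. Consider $$\mathcal L(Z,b)=\frac1N\sum_{k=1}^K\sum_{i=1}^{n_k}\ell_{CE}(z_{ki}+b,e_k)+\lambda_Z\|Z\|_*+\frac{\lambda_b}{2}\|b\|^2,\qquad Z=[z_{ki}]\in\mathbb{R}^{K\times N},\ b\in\mathbb{R}^K,$$ where $\|\cdot\|_*$ is the nuclear norm. Let $N_1,\dots,N_J$ be the distinct values of $n_1,\dots,n_K$, let $\Gamma_j=\{k: n_k=N_j\}$ be the clusters, $1_{\Gamma_j}\in\mathbb{R}^K$ their indicator vectors and $I_{\Gamma_j}=\mathrm{diag}(1_{\Gamma_j})$. Say that a $K\times K$ matrix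 has block structure if it is of the form $\sum_j a_j I_{\Gamma_j}+\sum_{j,j'}a_{jj'}1_{\Gamma_j}1_{\Gamma_{j'}}^\top$ with real $a_j,a_{jj'}$. Then $\mathcal L$ has a unique global minimizer $(Z,b)$. With $\bar z_k=\frac1{n_k}\sum_i z_{ki}$ and $\bar Z=[\bar z_1,\dots,\bar z_K]$ it has the following properties. (a) $z_{ki}=\bar z_k$ for all $k,i$, that is, $Z=\bar ZY$; and $\langle\bar z_k,\mathbf 1_K\rangle=0$ for all $k$. (b) There are reals $a_j,a_{jj'},c_j$ with $$\bar Z=\sum_{j}a_jI_{\Gamma_j}+\sum_{j,j'}a_{jj'}1_{\Gamma_j}1_{\Gamma_{j'}}^\top,\qquad b=\sum_jc_j1_{\Gamma_j},\qquad a_j+\sum_{j'}a_{j'j}|\Gamma_{j'}|=0\ \text{ for all } j.$$ In particular, within each cluster all pairs of distinct classes have the same angle between their mean prediction vectors $\bar z_k$. (c) If $n_1=\dots=n_K=N/K$, then $b=0$ and $\bar Z=a(KI_K-J_K)$ with $J_K$ the all-ones matrix, where $a=0$ if $N\lambda_Z\ge\sqrt{N/K}$, and $a=\frac1K\log\Big(\frac{\sqrt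 K}{\sqrt N\lambda_Z}-K+1\Big)$ if $N\lambda_Z<\sqrt{N/K}$. (d) Let $\bar ZD^{1/2}=\bar U\bar\Sigma\bar V^\top$ be any singular value decomposition ($\bar U,\bar V$ orthogonal $K\times K$ matrices, $\bar\Sigma$ diagonal with nonnegative entries) and put $$W=\bar\Sigma^{1/2}\bar U^\top,\qquad \bar H=\bar\Sigma^{1/2}\bar V^\top D^{-1/2},\qquad H=\bar HY.$$ Then $\bar Z=W^\top\bar H$ and $Z=W^\top H$. The matrices $W^\top W$ and $\bar H^\top\bar H$ have block structure, and within each cluster all pairs of distinct columns of $\bar H$ have the same angle. Moreover, for all $\lambda_W,\lambda_H>0$ with $\sqrt{\lambda_W\lambda_H}=\lambda_Z$ and all $d\ge K$, the global minimizers $(W',H',b')\in\mathbb{R}^{d\times K}\times\mathbb{R}^{d\times N}\times\mathbb{R}^K$ of $$\frac1N\sum_{k,i}\ell_{CE}(W'^\top h'_{ki}+b',e_k)+\frac{\lambda_W}2\|W'\|_F^2+\frac{\lambda_H}2\|H'\|_F^2+\frac{\lambda_b}2\|b'\|^2$$ are exactly the triples with $b'=b$, $W'=(\lambda_H/\lambda_W)^{1/4}QW$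 and $H'=(\lambda_W/\lambda_H)^{1/4}QH$, where $Q\in\mathbb{R}^{d\times K}$ satisfies $Q^\top Q=I_K$. (The angle of a pair of vectors one of which is zero is taken to be $\pi/2$.) -/

import Mathlib

namespace UFM

open Matrix

noncomputable section

/-- Index set of the `N = ∑ k, n k` samples: the pair `⟨k, i⟩` is the `i`-th sample of class `k`. -/
abbrev Sample {K : ℕ} (n : Fin K → ℕ) : Type := (k : Fin K) × Fin (n k)

/-- The total number `N` of samples, as a real number. -/
def total {K : ℕ} (n : Fin K → ℕ) : ℝ := ∑ k, (n k : ℝ)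

/-- The label matrix `Y`, whose column `⟨k, i⟩` is the one-hot vector `e_k`. -/
def labels {K : ℕ} (n : Fin K → ℕ) : Matrix (Fin K) (Sample n) ℝ :=
  Matrix.of fun l s => if l = s.1 then 1 else 0

/-- The cross-entropy loss of the prediction vector `z` for the label `k`. -/
def crossEntropy {K : ℕ} (z : Fin K → ℝ) (k : Fin K) : ℝ :=
  Real.log (∑ l, Real.exp (z l)) - z k

/-- The nuclear norm: the sum of the singular values. -/
def nuclearNorm {ι κ : Type*} [Fintype ι] [Fintype κ] [DecidableEq κ]
    (A : Matrix ι κ ℝ) : ℝ :=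
  (Matrix.toEuclideanLin A).singularValues.sum fun _ s => s

/-- The squared Frobenius norm. -/
def frobSq {ι κ : Type*} [Fintype ι] [Fintype κ] (A : Matrix ι κ ℝ) : ℝ :=
  ∑ i, ∑ j, A i j ^ 2

/-- The average cross-entropy loss of the predictions `Z + b 1ᵀ`. -/
def avgLoss {K : ℕ} (n : Fin K → ℕ) (Z : Matrix (Fin K) (Sample n) ℝ) (b : Fin K → ℝ) : ℝ :=
  (1 / total n) * ∑ k, ∑ i : Fin (n k), crossEntropy (fun l => Z l ⟨k, i⟩ + b l) k

/-- The convexified objective `L(Z, b)`. -/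
def convexObjective {K : ℕ} (n : Fin K → ℕ) (lamZ lamb : ℝ)
    (p : Matrix (Fin K) (Sample n) ℝ × (Fin K → ℝ)) : ℝ :=
  avgLoss n p.1 p.2 + lamZ * nuclearNorm p.1 + lamb / 2 * ∑ k, p.2 k ^ 2

/-- The factorized objective `L(W, H, b)` with feature dimension `d`. -/
def factorizedObjective {K : ℕ} (n : Fin K → ℕ) (lamW lamH lamb : ℝ) (d : ℕ)
    (p : Matrix (Fin d) (Fin K) ℝ × Matrix (Fin d) (Sample n) ℝ × (Fin K → ℝ)) : ℝ :=
  avgLoss n (p.1ᵀ * p.2.1) p.2.2 + lamW / 2 * frobSq p.1 + lamH / 2 * frobSq p.2.1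
    + lamb / 2 * ∑ k, p.2.2 k ^ 2

/-- The matrix `Z̄` whose `k`-th column is the sample mean of the columns of `Z` in class `k`. -/
def classMean {K : ℕ} (n : Fin K → ℕ) (Z : Matrix (Fin K) (Sample n) ℝ) :
    Matrix (Fin K) (Fin K) ℝ :=
  Matrix.of fun l k => (1 / (n k : ℝ)) * ∑ i : Fin (n k), Z l ⟨k, i⟩

/-- The cluster of all classes with exactly `m` samples. -/
def cluster {K : ℕ} (n : Fin K → ℕ) (m : ℕ) : Finset (Fin K) :=
  Finset.univ.filter fun k => n k = m

/-- The indicator vector of a set of classes. -/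
def indVec {K : ℕ} (s : Finset (Fin K)) : Fin K → ℝ := fun k => if k ∈ s then 1 else 0

/-- `blockMatrix n Ns a A = ∑ⱼ aⱼ I_{Γⱼ} + ∑_{j,j'} A_{jj'} 1_{Γⱼ} 1_{Γⱼ'}ᵀ`, where `Γⱼ` is the
cluster of the classes with `Ns j` samples. -/
def blockMatrix {K J : ℕ} (n : Fin K → ℕ) (Ns : Fin J → ℕ) (a : Fin J → ℝ)
    (A : Fin J → Fin J → ℝ) : Matrix (Fin K) (Fin K) ℝ :=
  ∑ j, a j • Matrix.diagonal (indVec (cluster n (Ns j)))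
    + ∑ j, ∑ j', A j j' • Matrix.vecMulVec (indVec (cluster n (Ns j))) (indVec (cluster n (Ns j')))

/-- Column `k` of a matrix as a vector of Euclidean space. -/
def colVec {ι κ : Type*} (M : Matrix ι κ ℝ) (k : κ) : EuclideanSpace ℝ ι :=
  WithLp.toLp 2 fun i => M i k

/-- Any two distinct columns of `M` that belong to the same cluster form the same angle, which
depends on the cluster only. -/
def EqualAngles {K : ℕ} {ι : Type*} [Fintype ι] (n : Fin K → ℕ) (M : Matrix ι (Fin K) ℝ) : Prop :=
  ∀ m : ℕ, ∀ k ∈ cluster n m, ∀ l ∈ cluster n m, ∀ k' ∈ cluster n m, ∀ l' ∈ cluster n m,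
    k ≠ l → k' ≠ l' →
    InnerProductGeometry.angle (colVec M k) (colVec M l) =
      InnerProductGeometry.angle (colVec M k') (colVec M l')

end

end UFM

/-!
The nuclear norm is the minimum of `(‖W‖² + ‖H‖²) / 2` over all factorizations `Wᵀ H`. Through such
factorizations, symmetries of `L` become properties of `Z`: centering the columns of `Wᵀ` costs
nothing in the loss and strictly decreases the norm unless they were centered already, so the
columns of a minimizer sum to zero; the loss is strictly convex modulo constants, so the minimizer
is unique, hence invariant under all permutations of samples and of classes that preserve the class
sizes. This is the block structure. For equal class sizes it leaves a single scalar, which is found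
by one-variable convexity.

For a singular value decomposition `Z = U Σ Vᵀ`, the optimal factorizations are exactly
`W = Q Σ^{1/2} Uᵀ`, `H = Q Σ^{1/2} Vᵀ` with `Qᵀ Q = 1`, because equality in
`tr (Uᵀ Wᵀ H V) ≤ (‖W‖² + ‖H‖²) / 2` forces `W U = H V`. The Gram matrix `Wᵀ W = U Σ Uᵀ` is the
positive square root of `Z̄ D Z̄ᵀ`, so it inherits the invariance of `Z̄`.
-/

namespace UFM

open Matrix

section Frobenius

variable {ι κ μ ν : Type*} [Fintype ι] [Fintype κ] [Fintype μ] [Fintype ν]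

theorem frobSq_eq_trace (A : Matrix ι κ ℝ) : frobSq A = (Aᵀ * A).trace := by
  simp only [frobSq, trace, diag, mul_apply, transpose_apply, sq]
  exact Finset.sum_comm

theorem frobSq_nonneg (A : Matrix ι κ ℝ) : 0 ≤ frobSq A :=
  Finset.sum_nonneg fun _ _ => Finset.sum_nonneg fun _ _ => sq_nonneg _

theorem frobSq_eq_zero_iff {A : Matrix ι κ ℝ} : frobSq A = 0 ↔ A = 0 := by
  rw [frobSq_eq_trace, ← conjTranspose_eq_transpose_of_trivial,
    trace_conjTranspose_mul_self_eq_zero_iff]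

theorem frobSq_smul (c : ℝ) (A : Matrix ι κ ℝ) : frobSq (c • A) = c ^ 2 * frobSq A := by
  simp only [frobSq, Matrix.smul_apply, smul_eq_mul, mul_pow, Finset.mul_sum]

theorem frobSq_fromRows (A : Matrix ι κ ℝ) (B : Matrix μ κ ℝ) :
    frobSq (fromRows A B) = frobSq A + frobSq B := by
  simp only [frobSq, Fintype.sum_sum_type, fromRows_apply_inl, fromRows_apply_inr]

theorem frobSq_submatrix (A : Matrix ι κ ℝ) (e : μ ≃ ι) (f : ν ≃ κ) :
    frobSq (A.submatrix e f) = frobSq A :=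
  (e.sum_comp fun i => ∑ j, A i (f j) ^ 2).trans <|
    Finset.sum_congr rfl fun i _ => f.sum_comp fun j => A i j ^ 2

theorem frobSq_mul_of_transpose_mul_self [DecidableEq ι] {Q : Matrix μ ι ℝ} (hQ : Qᵀ * Q = 1)
    (A : Matrix ι κ ℝ) : frobSq (Q * A) = frobSq A := by
  rw [frobSq_eq_trace, frobSq_eq_trace, transpose_mul, Matrix.mul_assoc, ← Matrix.mul_assoc Qᵀ,
    hQ, Matrix.one_mul]

theorem frobSq_mul_transpose_of_transpose_mul_self [DecidableEq κ] (R : Matrix ι κ ℝ)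
    {Q : Matrix μ κ ℝ} (hQ : Qᵀ * Q = 1) : frobSq (R * Qᵀ) = frobSq R := by
  rw [frobSq_eq_trace, frobSq_eq_trace, transpose_mul, trace_mul_comm, transpose_transpose,
    Matrix.mul_assoc, ← Matrix.mul_assoc Qᵀ, hQ, Matrix.one_mul, trace_mul_comm]

theorem two_mul_trace_add_frobSq_sub (X Y : Matrix ι κ ℝ) :
    2 * (Xᵀ * Y).trace + frobSq (X - Y) = frobSq X + frobSq Y := by
  have h : (Yᵀ * X).trace = (Xᵀ * Y).trace := by
    rw [← trace_transpose, transpose_mul, transpose_transpose]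
  simp only [frobSq_eq_trace, transpose_sub, Matrix.sub_mul, Matrix.mul_sub, trace_sub, h]
  ring

theorem trace_transpose_mul_projection {P : Matrix κ κ ℝ} (hP : IsIdempotentElem P)
    (hPt : P.IsSymm) (W : Matrix ι κ ℝ) : (Wᵀ * (W * P)).trace = frobSq (W * P) := by
  rw [frobSq_eq_trace, transpose_mul, hPt, Matrix.mul_assoc P, trace_mul_comm P, Matrix.mul_assoc,
    Matrix.mul_assoc W, hP]

theorem frobSq_mul_projection {P : Matrix κ κ ℝ} (hP : IsIdempotentElem P) (hPt : P.IsSymm)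
    (W : Matrix ι κ ℝ) : frobSq (W * P) + frobSq (W - W * P) = frobSq W := by
  linarith [two_mul_trace_add_frobSq_sub W (W * P), trace_transpose_mul_projection hP hPt W]

theorem frobSq_mul_partialIsometry {U : Matrix κ μ ℝ} (hU : U * Uᵀ * U = U) (W : Matrix ι κ ℝ) :
    frobSq (W * U) + frobSq (W - W * (U * Uᵀ)) = frobSq W := by
  have hidem : IsIdempotentElem (U * Uᵀ) := by rw [IsIdempotentElem, ← Matrix.mul_assoc, hU]
  have hsymm : (U * Uᵀ).IsSymm := by rw [IsSymm, transpose_mul, transpose_transpose]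
  have hrange : frobSq (W * (U * Uᵀ)) = frobSq (W * U) := by
    rw [← trace_transpose_mul_projection hidem hsymm, ← Matrix.mul_assoc W, ← Matrix.mul_assoc,
      trace_mul_comm, ← Matrix.mul_assoc, ← transpose_mul, ← frobSq_eq_trace]
  rw [← frobSq_mul_projection hidem hsymm W, hrange]

/-- The three defects vanish exactly when `W` and `H` are balanced and supported on the ranges
of `U` and `V`. -/
theorem two_mul_trace_add_defects {U : Matrix ι ν ℝ} {V : Matrix κ ν ℝ}
    (hU : U * Uᵀ * U = U) (hV : V * Vᵀ * V = V) (W : Matrix μ ι ℝ) (H : Matrix μ κ ℝ) :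
    2 * (Uᵀ * (Wᵀ * H) * V).trace + frobSq (W * U - H * V) + frobSq (W - W * (U * Uᵀ))
      + frobSq (H - H * (V * Vᵀ)) = frobSq W + frobSq H := by
  have h := two_mul_trace_add_frobSq_sub (W * U) (H * V)
  have htrace : (W * U)ᵀ * (H * V) = Uᵀ * (Wᵀ * H) * V := by
    simp only [transpose_mul, Matrix.mul_assoc]
  rw [htrace] at h
  linarith [frobSq_mul_partialIsometry hU W, frobSq_mul_partialIsometry hV H]

theorem trace_le_of_partialIsometry {U : Matrix ι ν ℝ} {V : Matrix κ ν ℝ}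
    (hU : U * Uᵀ * U = U) (hV : V * Vᵀ * V = V) (W : Matrix μ ι ℝ) (H : Matrix μ κ ℝ) :
    (Uᵀ * (Wᵀ * H) * V).trace ≤ (frobSq W + frobSq H) / 2 := by
  linarith [two_mul_trace_add_defects hU hV W H, frobSq_nonneg (W * U - H * V),
    frobSq_nonneg (W - W * (U * Uᵀ)), frobSq_nonneg (H - H * (V * Vᵀ))]

theorem eq_mul_of_trace_eq_of_partialIsometry {U : Matrix ι ν ℝ} {V : Matrix κ ν ℝ}
    (hU : U * Uᵀ * U = U) (hV : V * Vᵀ * V = V) {W : Matrix μ ι ℝ} {H : Matrix μ κ ℝ}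
    (h : (Uᵀ * (Wᵀ * H) * V).trace = (frobSq W + frobSq H) / 2) :
    W * U = H * V ∧ W = W * (U * Uᵀ) ∧ H = H * (V * Vᵀ) := by
  have hsum := two_mul_trace_add_defects hU hV W H
  have hbalance := frobSq_nonneg (W * U - H * V)
  have hrangeU := frobSq_nonneg (W - W * (U * Uᵀ))
  have hrangeV := frobSq_nonneg (H - H * (V * Vᵀ))
  refine ⟨?_, ?_, ?_⟩ <;> refine sub_eq_zero.1 (frobSq_eq_zero_iff.1 ?_) <;> linarith

end Frobenius

section Columns

theorem transpose_mul_apply_eq_inner {ι κ : Type*} [Fintype ι] (M N : Matrix ι κ ℝ) (i j : κ) :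
    (Mᵀ * N) i j = inner ℝ (colVec M i) (colVec N j) := by
  simp only [colVec, mul_apply, transpose_apply, PiLp.inner_apply, RCLike.inner_apply,
    conj_trivial, mul_comm]

theorem orthonormal_colVec_iff {ι κ : Type*} [Fintype ι] [DecidableEq κ] {M : Matrix ι κ ℝ} :
    Orthonormal ℝ (colVec M) ↔ Mᵀ * M = 1 := by
  simp only [orthonormal_iff_ite, ← transpose_mul_apply_eq_inner, ← Matrix.ext_iff, one_apply]

theorem colVec_mul {ι κ ν : Type*} [Fintype κ] [DecidableEq κ] (A : Matrix ι κ ℝ)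
    (V : Matrix κ ν ℝ) (i : ν) : colVec (A * V) i = toEuclideanLin A (colVec V i) := rfl

end Columns

section BalancedFactor

variable {ι κ ν : Type*} [Fintype ν] [DecidableEq ν] {σ : ν → ℝ}

/-- The factor `Σ^{1/2} Uᵀ` of a singular value decomposition `A = U Σ Vᵀ`. -/
noncomputable def balancedFactor (σ : ν → ℝ) (U : Matrix ι ν ℝ) : Matrix ν ι ℝ :=
  diagonal (fun i => √(σ i)) * Uᵀ

theorem transpose_balancedFactor_mul (hσ : ∀ i, 0 ≤ σ i) (U : Matrix ι ν ℝ) (V : Matrix κ ν ℝ) :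
    (balancedFactor σ U)ᵀ * balancedFactor σ V = U * diagonal σ * Vᵀ := by
  simp only [balancedFactor, transpose_mul, transpose_transpose, diagonal_transpose,
    Matrix.mul_assoc]
  rw [← Matrix.mul_assoc (diagonal _), diagonal_mul_diagonal]
  simp only [Real.mul_self_sqrt (hσ _)]

theorem frobSq_balancedFactor [Fintype ι] (hσ : ∀ i, 0 ≤ σ i) {U : Matrix ι ν ℝ}
    (hU : Uᵀ * U * diagonal σ = diagonal σ) : frobSq (balancedFactor σ U) = ∑ i, σ i := by
  rw [frobSq_eq_trace, transpose_balancedFactor_mul hσ, trace_mul_comm, ← Matrix.mul_assoc, hU,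
    trace_diagonal]

end BalancedFactor

section SingularValues

variable {ι κ μ ν : Type*} [Fintype ι] [Fintype κ] [Fintype μ] [Fintype ν] [DecidableEq κ]

theorem nuclearNorm_eq_sum_fin (A : Matrix ι κ ℝ) :
    nuclearNorm A = ∑ i : Fin (Fintype.card κ), (toEuclideanLin A).singularValues i := by
  rw [nuclearNorm, Fin.sum_univ_eq_sum_range (toEuclideanLin A).singularValues]
  refine Finsupp.sum_of_support_subset _ (fun i hi => ?_) _ fun _ _ => rfl
  by_contra h
  rw [Finset.mem_range, not_lt] at h
  exact Finsupp.mem_support_iff.1 hi (LinearMap.singularValues_of_finrank_le _ (by simpa using h))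

theorem exists_rightSingularVectors (A : Matrix ι κ ℝ) :
    ∃ (V : Matrix κ (Fin (Fintype.card κ)) ℝ) (σ : Fin (Fintype.card κ) → ℝ),
      (∀ i, 0 ≤ σ i) ∧ Vᵀ * V = 1 ∧ V * Vᵀ = 1 ∧
      (A * V)ᵀ * (A * V) = diagonal (fun i => σ i ^ 2) ∧ nuclearNorm A = ∑ i, σ i := by
  set T := toEuclideanLin A
  set v := T.isSymmetric_adjoint_comp_self.eigenvectorBasis finrank_euclideanSpace with hv
  have hV : (of fun k i => v i k)ᵀ * of (fun k i => v i k) =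
      (1 : Matrix (Fin (Fintype.card κ)) _ ℝ) := orthonormal_colVec_iff.1 v.orthonormal
  have hT (i j) : inner ℝ (T (v i)) (T (v j)) = T.singularValues j ^ 2 * inner ℝ (v i) (v j) := by
    rw [← LinearMap.adjoint_inner_right, ← LinearMap.comp_apply,
      LinearMap.IsSymmetric.apply_eigenvectorBasis, T.sq_singularValues_fin finrank_euclideanSpace,
      ← hv, inner_smul_right, RCLike.ofReal_real_eq_id, id]
  refine ⟨of fun k i => v i k, fun i => T.singularValues i, fun i => T.singularValues_nonneg i, hV,
    (mul_eq_one_comm_of_equiv (Fintype.equivOfCardEq (by simp))).1 hV, ?_,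
    nuclearNorm_eq_sum_fin A⟩
  ext i j
  rw [transpose_mul_apply_eq_inner, colVec_mul, colVec_mul]
  refine (hT i j).trans ?_
  rw [orthonormal_iff_ite.1 v.orthonormal, diagonal_apply]
  split_ifs with h
  · rw [h, mul_one]
  · rw [mul_zero]

/-- The left singular vectors belonging to the singular value `0` may be chosen to vanish, so the
columns of `U` are orthonormal only on the support of `σ`. -/
theorem exists_svd (A : Matrix ι κ ℝ) :
    ∃ (U : Matrix ι (Fin (Fintype.card κ)) ℝ) (σ : Fin (Fintype.card κ) → ℝ)
      (V : Matrix κ (Fin (Fintype.card κ)) ℝ), (∀ i, 0 ≤ σ i) ∧ U * Uᵀ * U = U ∧ Vᵀ * V = 1 ∧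
      Uᵀ * U * diagonal σ = diagonal σ ∧ A = U * diagonal σ * Vᵀ ∧ nuclearNorm A = ∑ i, σ i := by
  obtain ⟨V, σ, hσ, hV, hV', hAV, hN⟩ := exists_rightSingularVectors A
  set U := A * V * diagonal fun i => (σ i)⁻¹ with hU
  have hUU : Uᵀ * U = diagonal fun i => (σ i)⁻¹ * σ i := by
    rw [hU, transpose_mul, Matrix.mul_assoc, ← Matrix.mul_assoc (A * V)ᵀ, hAV, diagonal_transpose,
      diagonal_mul_diagonal, diagonal_mul_diagonal]
    congr 1 with i
    rw [sq, mul_self_mul_inv]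
  have hker : A * V * diagonal (fun i => 1 - (σ i)⁻¹ * σ i) = 0 := by
    rw [← conjTranspose_mul_self_eq_zero, conjTranspose_eq_transpose_of_trivial, transpose_mul,
      Matrix.mul_assoc, ← Matrix.mul_assoc (A * V)ᵀ, hAV, diagonal_transpose,
      diagonal_mul_diagonal, diagonal_mul_diagonal, diagonal_eq_zero]
    ext i
    rw [mul_sub, mul_one, sq, mul_assoc, ← mul_assoc (σ i) _ (σ i), mul_inv_mul_cancel, sub_self,
      mul_zero, Pi.zero_apply]
  have hAV' : U * diagonal σ = A * V := by
    rw [← diagonal_sub, diagonal_one, Matrix.mul_sub, Matrix.mul_one, sub_eq_zero] at hker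
    rw [hU, Matrix.mul_assoc, diagonal_mul_diagonal, ← hker]
  refine ⟨U, σ, V, hσ, ?_, hV, ?_, ?_, hN⟩
  · rw [Matrix.mul_assoc, hUU, hU, Matrix.mul_assoc, diagonal_mul_diagonal]
    congr 2 with i
    simpa only [mul_assoc, inv_inv] using mul_self_mul_inv (σ i)⁻¹
  · simp only [hUU, diagonal_mul_diagonal, inv_mul_mul_self]
  · rw [hAV', Matrix.mul_assoc, hV', Matrix.mul_one]

theorem nuclearNorm_le (W : Matrix μ ι ℝ) (H : Matrix μ κ ℝ) :
    nuclearNorm (Wᵀ * H) ≤ (frobSq W + frobSq H) / 2 := by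
  obtain ⟨U, σ, V, -, hU, hV, hUσ, hA, hN⟩ := exists_svd (Wᵀ * H)
  have htrace : Uᵀ * (Wᵀ * H) * V = diagonal σ := by
    rw [hA, Matrix.mul_assoc, Matrix.mul_assoc _ Vᵀ, hV, Matrix.mul_one, ← Matrix.mul_assoc, hUσ]
  rw [hN, ← trace_diagonal, ← htrace]
  exact trace_le_of_partialIsometry hU (by rw [Matrix.mul_assoc, hV, Matrix.mul_one]) W H

theorem exists_factorization (A : Matrix ι κ ℝ) :
    ∃ (W : Matrix (Fin (Fintype.card κ)) ι ℝ) (H : Matrix (Fin (Fintype.card κ)) κ ℝ),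
      Wᵀ * H = A ∧ (frobSq W + frobSq H) / 2 = nuclearNorm A := by
  obtain ⟨U, σ, V, hσ, -, hV, hUσ, hA, hN⟩ := exists_svd A
  refine ⟨balancedFactor σ U, balancedFactor σ V, ?_, ?_⟩
  · rw [transpose_balancedFactor_mul hσ, ← hA]
  · rw [frobSq_balancedFactor hσ hUσ, frobSq_balancedFactor hσ (by rw [hV, Matrix.one_mul]), hN,
      add_self_div_two]

theorem trace_le_nuclearNorm {U : Matrix ι ν ℝ} {V : Matrix κ ν ℝ} (hU : U * Uᵀ * U = U)
    (hV : V * Vᵀ * V = V) (A : Matrix ι κ ℝ) : (Uᵀ * A * V).trace ≤ nuclearNorm A := by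
  obtain ⟨W, H, hA, hN⟩ := exists_factorization A
  rw [← hN, ← hA]
  exact trace_le_of_partialIsometry hU hV W H

theorem nuclearNorm_nonneg (A : Matrix ι κ ℝ) : 0 ≤ nuclearNorm A := by
  obtain ⟨W, H, -, hN⟩ := exists_factorization A
  linarith [frobSq_nonneg W, frobSq_nonneg H]

theorem abs_apply_le_nuclearNorm (A : Matrix ι κ ℝ) (i : ι) (j : κ) :
    |A i j| ≤ nuclearNorm A := by
  classical
  have hentry (c : ℝ) (hc : c * c = 1) : c * A i j ≤ nuclearNorm A := by
    have h := trace_le_nuclearNorm (U := single i () c) (V := single j () 1)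
      (by simp [hc]) (by simp) A
    simpa [trace] using h
  exact abs_le'.2 ⟨by simpa using hentry 1 (by norm_num), by simpa using hentry (-1) (by norm_num)⟩

theorem nuclearNorm_add_le (A B : Matrix ι κ ℝ) :
    nuclearNorm (A + B) ≤ nuclearNorm A + nuclearNorm B := by
  obtain ⟨W, H, hA, hA'⟩ := exists_factorization A
  obtain ⟨X, Y, hB, hB'⟩ := exists_factorization B
  have h := nuclearNorm_le (fromRows W X) (fromRows H Y)
  rw [frobSq_fromRows, frobSq_fromRows, transpose_fromRows, fromCols_mul_fromRows, hA, hB] at h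
  linarith

theorem nuclearNorm_smul_le (c : ℝ) (A : Matrix ι κ ℝ) :
    nuclearNorm (c • A) ≤ |c| * nuclearNorm A := by
  obtain ⟨W, H, hA, hN⟩ := exists_factorization A
  have hsq : (c / √|c|) ^ 2 = |c| := by
    rw [div_pow, Real.sq_sqrt (abs_nonneg c), ← sq_abs, sq, mul_self_div_self]
  have hmul : c / √|c| * √|c| = c := div_mul_cancel_of_imp fun h => by simpa using h
  have h := nuclearNorm_le ((c / √|c|) • W) (√|c| • H)
  rw [frobSq_smul, frobSq_smul, hsq, Real.sq_sqrt (abs_nonneg c), transpose_smul, Matrix.smul_mul,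
    Matrix.mul_smul, smul_smul, hmul, hA] at h
  rw [← hN]
  linarith

theorem nuclearNorm_smul (c : ℝ) (A : Matrix ι κ ℝ) :
    nuclearNorm (c • A) = |c| * nuclearNorm A := by
  refine le_antisymm (nuclearNorm_smul_le c A) ?_
  rcases eq_or_ne c 0 with rfl | hc
  · simpa only [abs_zero, zero_mul] using nuclearNorm_nonneg _
  · have h := nuclearNorm_smul_le c⁻¹ (c • A)
    rwa [inv_smul_smul₀ hc, abs_inv, ← div_eq_inv_mul, le_div_iff₀' (abs_pos.2 hc)] at h

theorem convexOn_nuclearNorm : ConvexOn ℝ Set.univ (nuclearNorm : Matrix ι κ ℝ → ℝ) := by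
  refine ⟨convex_univ, fun A _ B _ s t hs ht _ => (nuclearNorm_add_le _ _).trans_eq ?_⟩
  rw [nuclearNorm_smul, nuclearNorm_smul, abs_of_nonneg hs, abs_of_nonneg ht, smul_eq_mul,
    smul_eq_mul]

theorem nuclearNorm_mul_gram_mul_transpose [DecidableEq ν] {U : Matrix ι ν ℝ} {V : Matrix κ ν ℝ}
    (hU : Uᵀ * U = 1) (hV : Vᵀ * V = 1) (R : Matrix μ ν ℝ) :
    nuclearNorm (U * (Rᵀ * R) * Vᵀ) = frobSq R := by
  refine le_antisymm ?_ ?_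
  · have h := nuclearNorm_le (R * Uᵀ) (R * Vᵀ)
    rw [frobSq_mul_transpose_of_transpose_mul_self R hU,
      frobSq_mul_transpose_of_transpose_mul_self R hV, add_self_div_two] at h
    simpa only [transpose_mul, transpose_transpose, Matrix.mul_assoc] using h
  · have h := trace_le_nuclearNorm (U := U) (V := V) (by rw [Matrix.mul_assoc, hU, Matrix.mul_one])
      (by rw [Matrix.mul_assoc, hV, Matrix.mul_one]) (U * (Rᵀ * R) * Vᵀ)
    have htrace : Uᵀ * (U * (Rᵀ * R) * Vᵀ) * V = Rᵀ * R := by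
      rw [Matrix.mul_assoc, Matrix.mul_assoc _ Vᵀ, hV, Matrix.mul_one, ← Matrix.mul_assoc, hU,
        Matrix.one_mul]
    rwa [htrace, ← frobSq_eq_trace] at h

theorem nuclearNorm_submatrix_le [DecidableEq ν] (A : Matrix ι κ ℝ) (e : μ ≃ ι) (f : ν ≃ κ) :
    nuclearNorm (A.submatrix e f) ≤ nuclearNorm A := by
  obtain ⟨W, H, hA, hN⟩ := exists_factorization A
  have h := nuclearNorm_le (W.submatrix (Equiv.refl _) e) (H.submatrix (Equiv.refl _) f)
  rwa [transpose_submatrix, submatrix_mul_equiv, hA, frobSq_submatrix, frobSq_submatrix, hN] at h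

theorem nuclearNorm_submatrix [DecidableEq ν] (A : Matrix ι κ ℝ) (e : μ ≃ ι) (f : ν ≃ κ) :
    nuclearNorm (A.submatrix e f) = nuclearNorm A := by
  refine le_antisymm (nuclearNorm_submatrix_le A e f) ?_
  simpa using nuclearNorm_submatrix_le (A.submatrix e f) e.symm f.symm

theorem mul_eq_of_nuclearNorm_le_projection_mul {P : Matrix ι ι ℝ} (hP : IsIdempotentElem P)
    (hPt : P.IsSymm) {A : Matrix ι κ ℝ} (h : nuclearNorm A ≤ nuclearNorm (P * A)) : P * A = A := by
  obtain ⟨W, H, hA, hN⟩ := exists_factorization A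
  have hle := nuclearNorm_le (W * P) H
  rw [transpose_mul, hPt, Matrix.mul_assoc, hA] at hle
  have hW : W - W * P = 0 := frobSq_eq_zero_iff.1 <|
    le_antisymm (by linarith [frobSq_mul_projection hP hPt W]) (frobSq_nonneg _)
  rw [← hA, ← Matrix.mul_assoc, ← hPt, ← transpose_mul, ← sub_eq_zero.1 hW]

end SingularValues

section CrossEntropy

/-- The vector with entries `exp (zₗ / 2)`. Its squared norm is `∑ exp zₗ`, and inner products of
such vectors are `∑ exp ((zₗ + wₗ) / 2)`, which turns the convexity of the cross-entropy into the
Cauchy–Schwarz inequality. -/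
noncomputable def halfExp {ι : Type*} (z : ι → ℝ) : EuclideanSpace ℝ ι :=
  WithLp.toLp 2 fun l => Real.exp (z l / 2)

section HalfExp

variable {ι : Type*} [Fintype ι] (z w : ι → ℝ)

theorem inner_halfExp :
    inner ℝ (halfExp z) (halfExp w) = ∑ l, Real.exp (((1 / 2 : ℝ) • (z + w)) l) := by
  simp only [halfExp, PiLp.inner_apply, RCLike.inner_apply, conj_trivial, ← Real.exp_add,
    Pi.smul_apply, Pi.add_apply, smul_eq_mul]
  exact Finset.sum_congr rfl fun l _ => by ring_nf

theorem norm_halfExp_sq : ‖halfExp z‖ ^ 2 = ∑ l, Real.exp (z l) := by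
  rw [← real_inner_self_eq_norm_sq, inner_halfExp, ← two_smul ℝ z, one_div,
    inv_smul_smul₀ two_ne_zero]

theorem norm_halfExp_pos [Nonempty ι] : 0 < ‖halfExp z‖ := by
  have h : 0 < ‖halfExp z‖ ^ 2 := by
    rw [norm_halfExp_sq]
    exact Finset.sum_pos (fun _ _ => Real.exp_pos _) Finset.univ_nonempty
  exact (sq_pos_iff.1 h).lt_of_le' (norm_nonneg _)

end HalfExp

variable {K : ℕ}

theorem sum_exp_pos (z : Fin K → ℝ) (k : Fin K) : 0 < ∑ l, Real.exp (z l) :=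
  Finset.sum_pos (fun _ _ => Real.exp_pos _) ⟨k, Finset.mem_univ _⟩

theorem crossEntropy_nonneg (z : Fin K → ℝ) (k : Fin K) : 0 ≤ crossEntropy z k := by
  rw [crossEntropy, sub_nonneg, Real.le_log_iff_exp_le (sum_exp_pos z k)]
  exact Finset.single_le_sum (fun l _ => (Real.exp_pos (z l)).le) (Finset.mem_univ k)

theorem crossEntropy_add_const (z : Fin K → ℝ) (c : ℝ) (k : Fin K) :
    crossEntropy (fun l => z l + c) k = crossEntropy z k := by
  simp only [crossEntropy, Real.exp_add, ← Finset.sum_mul]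
  rw [Real.log_mul (sum_exp_pos z k).ne' (Real.exp_pos c).ne', Real.log_exp]
  ring

theorem crossEntropy_comp_perm (z : Fin K → ℝ) (τ : Equiv.Perm (Fin K)) (k : Fin K) :
    crossEntropy (fun l => z (τ l)) k = crossEntropy z (τ k) := by
  rw [crossEntropy, crossEntropy, Equiv.sum_comp τ fun l => Real.exp (z l)]

theorem crossEntropy_eq_log_norm_halfExp (z : Fin K → ℝ) (k : Fin K) :
    crossEntropy z k = 2 * Real.log ‖halfExp z‖ - z k := by
  rw [crossEntropy, ← norm_halfExp_sq, Real.log_pow, Nat.cast_ofNat]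

theorem crossEntropy_midpoint (z w : Fin K → ℝ) (k : Fin K) :
    crossEntropy ((1 / 2 : ℝ) • (z + w)) k =
      Real.log (inner ℝ (halfExp z) (halfExp w)) - (z k + w k) / 2 := by
  rw [crossEntropy, inner_halfExp, Pi.smul_apply, Pi.add_apply, smul_eq_mul, one_div_mul_eq_div]

theorem average_crossEntropy (z w : Fin K → ℝ) (k : Fin K) :
    (crossEntropy z k + crossEntropy w k) / 2 =
      Real.log (‖halfExp z‖ * ‖halfExp w‖) - (z k + w k) / 2 := by
  have : Nonempty (Fin K) := ⟨k⟩
  rw [Real.log_mul (norm_halfExp_pos z).ne' (norm_halfExp_pos w).ne',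
    crossEntropy_eq_log_norm_halfExp, crossEntropy_eq_log_norm_halfExp]
  ring

theorem inner_halfExp_pos (z w : Fin K → ℝ) (k : Fin K) :
    0 < inner ℝ (halfExp z) (halfExp w) := by
  rw [inner_halfExp]
  exact sum_exp_pos _ k

theorem crossEntropy_midpoint_le (z w : Fin K → ℝ) (k : Fin K) :
    crossEntropy ((1 / 2 : ℝ) • (z + w)) k ≤ (crossEntropy z k + crossEntropy w k) / 2 := by
  rw [crossEntropy_midpoint, average_crossEntropy]
  gcongr
  · exact inner_halfExp_pos z w k
  · exact real_inner_le_norm _ _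

theorem exists_eq_add_const_of_crossEntropy_midpoint_eq {z w : Fin K → ℝ} {k : Fin K}
    (h : crossEntropy ((1 / 2 : ℝ) • (z + w)) k = (crossEntropy z k + crossEntropy w k) / 2) :
    ∃ c, ∀ l, z l = w l + c := by
  have : Nonempty (Fin K) := ⟨k⟩
  have hz := norm_halfExp_pos z
  have hw := norm_halfExp_pos w
  rw [crossEntropy_midpoint, average_crossEntropy, sub_left_inj] at h
  have hcauchy := inner_eq_norm_mul_iff_real.1 <|
    Real.log_injOn_pos (inner_halfExp_pos z w k) (mul_pos hz hw) h
  refine ⟨2 * (Real.log ‖halfExp z‖ - Real.log ‖halfExp w‖), fun l => ?_⟩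
  have hl : ‖halfExp w‖ * Real.exp (z l / 2) = ‖halfExp z‖ * Real.exp (w l / 2) :=
    congrArg (fun x : EuclideanSpace ℝ (Fin K) => x l) hcauchy
  have hlog := congrArg Real.log hl
  rw [Real.log_mul hw.ne' (Real.exp_pos _).ne', Real.log_mul hz.ne' (Real.exp_pos _).ne',
    Real.log_exp, Real.log_exp] at hlog
  linarith

end CrossEntropy

section AverageLoss

variable {K : ℕ} {n : Fin K → ℕ}

theorem avgLoss_eq (Z : Matrix (Fin K) (Sample n) ℝ) (b : Fin K → ℝ) :
    avgLoss n Z b = (1 / total n) * ∑ s, crossEntropy (fun l => Z l s + b l) s.1 := by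
  rw [avgLoss, Fintype.sum_sigma]

theorem total_nonneg (n : Fin K → ℕ) : 0 ≤ total n :=
  Finset.sum_nonneg fun _ _ => Nat.cast_nonneg _

theorem total_pos_of_sample (s : Sample n) : 0 < total n :=
  Finset.sum_pos' (fun _ _ => Nat.cast_nonneg _)
    ⟨s.1, Finset.mem_univ _, Nat.cast_pos.2 s.2.pos⟩

theorem avgLoss_nonneg (Z : Matrix (Fin K) (Sample n) ℝ) (b : Fin K → ℝ) : 0 ≤ avgLoss n Z b := by
  rw [avgLoss_eq]
  exact mul_nonneg (one_div_nonneg.2 (total_nonneg n))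
    (Finset.sum_nonneg fun s _ => crossEntropy_nonneg _ _)

theorem continuous_avgLoss :
    Continuous fun p : Matrix (Fin K) (Sample n) ℝ × (Fin K → ℝ) => avgLoss n p.1 p.2 := by
  simp only [avgLoss_eq, crossEntropy]
  refine continuous_const.mul (continuous_finsetSum _ fun s _ => .sub ?_ (by fun_prop))
  exact .log (by fun_prop) fun p => (sum_exp_pos _ s.1).ne'

theorem avgLoss_congr_of_add_const {Z Z' : Matrix (Fin K) (Sample n) ℝ} {b b' : Fin K → ℝ}
    (c : Sample n → ℝ) (h : ∀ l s, Z' l s + b' l = Z l s + b l + c s) :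
    avgLoss n Z' b' = avgLoss n Z b := by
  simp only [avgLoss_eq, h, crossEntropy_add_const]

theorem avgLoss_submatrix (Z : Matrix (Fin K) (Sample n) ℝ) (b : Fin K → ℝ)
    (τ : Equiv.Perm (Fin K)) (e : Equiv.Perm (Sample n)) (he : ∀ s, (e s).1 = τ s.1) :
    avgLoss n (Z.submatrix τ e) (b ∘ τ) = avgLoss n Z b := by
  rw [avgLoss_eq, avgLoss_eq, ← Equiv.sum_comp e fun s => crossEntropy (fun l => Z l s + b l) s.1]
  simp only [he, ← crossEntropy_comp_perm, submatrix_apply, Function.comp_apply]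

theorem avgLoss_midpoint (Z Z' : Matrix (Fin K) (Sample n) ℝ) (b b' : Fin K → ℝ) :
    avgLoss n ((1 / 2 : ℝ) • (Z + Z')) ((1 / 2 : ℝ) • (b + b')) = (1 / total n) * ∑ s,
      crossEntropy ((1 / 2 : ℝ) • ((fun l => Z l s + b l) + fun l => Z' l s + b' l)) s.1 := by
  rw [avgLoss_eq]
  congr! with s _ l
  simp only [Matrix.smul_apply, Matrix.add_apply, Pi.smul_apply, Pi.add_apply, smul_eq_mul]
  ring

theorem average_avgLoss (Z Z' : Matrix (Fin K) (Sample n) ℝ) (b b' : Fin K → ℝ) :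
    (avgLoss n Z b + avgLoss n Z' b') / 2 = (1 / total n) *
      ∑ s, (crossEntropy (fun l => Z l s + b l) s.1 +
        crossEntropy (fun l => Z' l s + b' l) s.1) / 2 := by
  rw [avgLoss_eq, avgLoss_eq, ← Finset.sum_div, Finset.sum_add_distrib]
  ring

theorem avgLoss_midpoint_le (Z Z' : Matrix (Fin K) (Sample n) ℝ) (b b' : Fin K → ℝ) :
    avgLoss n ((1 / 2 : ℝ) • (Z + Z')) ((1 / 2 : ℝ) • (b + b')) ≤
      (avgLoss n Z b + avgLoss n Z' b') / 2 := by
  rw [avgLoss_midpoint, average_avgLoss]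
  exact mul_le_mul_of_nonneg_left (Finset.sum_le_sum fun s _ => crossEntropy_midpoint_le _ _ _)
    (one_div_nonneg.2 (total_nonneg n))

theorem exists_eq_add_const_of_avgLoss_midpoint_eq {Z Z' : Matrix (Fin K) (Sample n) ℝ}
    {b b' : Fin K → ℝ} (h : avgLoss n ((1 / 2 : ℝ) • (Z + Z')) ((1 / 2 : ℝ) • (b + b')) =
      (avgLoss n Z b + avgLoss n Z' b') / 2) (s : Sample n) :
    ∃ c, ∀ l, Z l s + b l = Z' l s + b' l + c := by
  rw [avgLoss_midpoint, average_avgLoss,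
    mul_right_inj' (one_div_pos.2 (total_pos_of_sample s)).ne'] at h
  exact exists_eq_add_const_of_crossEntropy_midpoint_eq <|
    (Finset.sum_eq_sum_iff_of_le fun s _ => crossEntropy_midpoint_le _ _ _).1 h s
      (Finset.mem_univ s)

end AverageLoss

section Centering

variable {ι κ : Type*} [Fintype ι] [DecidableEq ι]

/-- The orthogonal projection onto the vectors with coordinate sum zero. -/
noncomputable def centering (ι : Type*) [Fintype ι] [DecidableEq ι] : Matrix ι ι ℝ :=
  1 - of fun _ _ => (Fintype.card ι : ℝ)⁻¹

theorem centering_mul_apply (A : Matrix ι κ ℝ) (i : ι) (j : κ) :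
    (centering ι * A) i j = A i j - (Fintype.card ι : ℝ)⁻¹ * ∑ l, A l j := by
  rw [centering, Matrix.sub_mul, Matrix.one_mul, Matrix.sub_apply, mul_apply, Finset.mul_sum]
  rfl

theorem sum_centering_mul_apply (A : Matrix ι κ ℝ) (j : κ) : ∑ i, (centering ι * A) i j = 0 := by
  cases isEmpty_or_nonempty ι
  · exact Finset.sum_of_isEmpty _
  · simp [centering_mul_apply]

theorem isSymm_centering : (centering ι).IsSymm :=
  isSymm_one.sub (IsSymm.ext fun _ _ => rfl)

theorem isIdempotentElem_centering : IsIdempotentElem (centering ι) := by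
  ext i j
  rw [centering_mul_apply, ← Matrix.mul_one (centering ι), sum_centering_mul_apply, mul_zero,
    sub_zero]

end Centering

section ConvexObjective

variable {K : ℕ} {n : Fin K → ℕ} {lamZ lamb : ℝ}

section
open scoped Matrix.Norms.Elementwise

theorem continuous_nuclearNorm {ι κ : Type*} [Fintype ι] [Fintype κ] [DecidableEq κ] :
    Continuous (nuclearNorm : Matrix ι κ ℝ → ℝ) :=
  continuousOn_univ.1 (convexOn_nuclearNorm.continuousOn isOpen_univ)

theorem continuous_convexObjective : Continuous (convexObjective n lamZ lamb) := by
  have h : Continuous fun p : Matrix (Fin K) (Sample n) ℝ × (Fin K → ℝ) => nuclearNorm p.1 :=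
    continuous_nuclearNorm.comp continuous_fst
  exact (continuous_avgLoss.add (continuous_const.mul h)).add (by fun_prop)

theorem nuclearNorm_le_convexObjective (hlamZ : 0 < lamZ) (hlamb : 0 < lamb)
    (p : Matrix (Fin K) (Sample n) ℝ × (Fin K → ℝ)) :
    nuclearNorm p.1 ≤ convexObjective n lamZ lamb p / lamZ := by
  rw [le_div_iff₀' hlamZ, convexObjective]
  have := avgLoss_nonneg p.1 p.2
  have : 0 ≤ lamb / 2 * ∑ k, p.2 k ^ 2 := by positivity
  linarith

theorem sq_le_convexObjective (hlamZ : 0 < lamZ) (hlamb : 0 < lamb)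
    (p : Matrix (Fin K) (Sample n) ℝ × (Fin K → ℝ)) (k : Fin K) :
    p.2 k ^ 2 ≤ convexObjective n lamZ lamb p / (lamb / 2) := by
  rw [le_div_iff₀' (half_pos hlamb), convexObjective]
  have := avgLoss_nonneg p.1 p.2
  have := mul_nonneg hlamZ.le (nuclearNorm_nonneg p.1)
  have := mul_le_mul_of_nonneg_left (Finset.single_le_sum (f := fun k => p.2 k ^ 2)
    (fun _ _ => sq_nonneg _) (Finset.mem_univ k)) (half_pos hlamb).le
  linarith

theorem exists_isMinOn_convexObjective (n : Fin K → ℕ) (hlamZ : 0 < lamZ) (hlamb : 0 < lamb) :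
    ∃ p, IsMinOn (convexObjective n lamZ lamb) Set.univ p := by
  have : ProperSpace (Matrix (Fin K) (Sample n) ℝ) := FiniteDimensional.proper_real _
  set c := convexObjective n lamZ lamb 0
  have hbounded : Bornology.IsBounded {p | convexObjective n lamZ lamb p ≤ c} := by
    refine isBounded_iff_forall_norm_le.2 ⟨max (c / lamZ) √(c / (lamb / 2)), fun p hp => ?_⟩
    have hnuc : nuclearNorm p.1 ≤ c / lamZ :=
      (nuclearNorm_le_convexObjective hlamZ hlamb p).trans (by gcongr; exact hp)
    refine max_le_max ?_ ?_
    · exact (norm_le_iff ((nuclearNorm_nonneg _).trans hnuc)).2 fun l s =>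
        (abs_apply_le_nuclearNorm p.1 l s).trans hnuc
    · refine (pi_norm_le_iff_of_nonneg (Real.sqrt_nonneg _)).2 fun k => Real.abs_le_sqrt ?_
      exact (sq_le_convexObjective hlamZ hlamb p k).trans (by gcongr; exact hp)
  obtain ⟨p, hp⟩ := continuous_convexObjective.exists_forall_le_of_isBounded 0 hbounded
  exact ⟨p, fun q _ => hp q⟩

end

theorem sum_eq_zero_of_isMinOn_convexObjective (hlamZ : 0 < lamZ)
    {Z : Matrix (Fin K) (Sample n) ℝ} {b : Fin K → ℝ}
    (h : IsMinOn (convexObjective n lamZ lamb) Set.univ (Z, b)) (s : Sample n) :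
    ∑ l, Z l s = 0 := by
  have hloss : avgLoss n (centering (Fin K) * Z) b = avgLoss n Z b := by
    refine avgLoss_congr_of_add_const (fun s => -((Fintype.card (Fin K) : ℝ)⁻¹ * ∑ l, Z l s))
      fun l s => ?_
    rw [centering_mul_apply]
    ring
  have hmin := isMinOn_univ_iff.1 h (centering (Fin K) * Z, b)
  simp only [convexObjective, hloss] at hmin
  have hnuc : nuclearNorm Z ≤ nuclearNorm (centering (Fin K) * Z) :=
    le_of_mul_le_mul_left (by linarith) hlamZ
  rw [← mul_eq_of_nuclearNorm_le_projection_mul isIdempotentElem_centering isSymm_centering hnuc]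
  exact sum_centering_mul_apply Z s

theorem sum_sq_midpoint {ι : Type*} [Fintype ι] (x y : ι → ℝ) :
    ∑ k, ((1 / 2 : ℝ) • (x + y)) k ^ 2 =
      (∑ k, x k ^ 2 + ∑ k, y k ^ 2) / 2 - (∑ k, (x k - y k) ^ 2) / 4 := by
  rw [← Finset.sum_add_distrib, Finset.sum_div, Finset.sum_div, ← Finset.sum_sub_distrib]
  refine Finset.sum_congr rfl fun k _ => ?_
  simp only [Pi.smul_apply, Pi.add_apply, smul_eq_mul]
  ring

theorem nuclearNorm_midpoint_le {ι κ : Type*} [Fintype ι] [Fintype κ] [DecidableEq κ]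
    (A B : Matrix ι κ ℝ) :
    nuclearNorm ((1 / 2 : ℝ) • (A + B)) ≤ (nuclearNorm A + nuclearNorm B) / 2 := by
  rw [nuclearNorm_smul, abs_of_pos one_half_pos, one_div_mul_eq_div]
  exact div_le_div_of_nonneg_right (nuclearNorm_add_le A B) zero_le_two

theorem midpoint_eq_of_isMinOn_convexObjective (hlamZ : 0 < lamZ) (hlamb : 0 < lamb)
    {Z Z' : Matrix (Fin K) (Sample n) ℝ} {b b' : Fin K → ℝ}
    (h : IsMinOn (convexObjective n lamZ lamb) Set.univ (Z, b))
    (h' : IsMinOn (convexObjective n lamZ lamb) Set.univ (Z', b')) :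
    b = b' ∧ avgLoss n ((1 / 2 : ℝ) • (Z + Z')) ((1 / 2 : ℝ) • (b + b')) =
      (avgLoss n Z b + avgLoss n Z' b') / 2 := by
  have hmin := isMinOn_univ_iff.1 h ((1 / 2 : ℝ) • (Z + Z'), (1 / 2 : ℝ) • (b + b'))
  have hmin' := isMinOn_univ_iff.1 h' ((1 / 2 : ℝ) • (Z + Z'), (1 / 2 : ℝ) • (b + b'))
  simp only [convexObjective, sum_sq_midpoint] at hmin hmin'
  have hloss := avgLoss_midpoint_le Z Z' b b'
  have hnuc := mul_le_mul_of_nonneg_left (nuclearNorm_midpoint_le Z Z') hlamZ.le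
  have hsq : 0 ≤ ∑ k, (b k - b' k) ^ 2 := Finset.sum_nonneg fun _ _ => sq_nonneg _
  have hsq' := mul_nonneg hlamb.le hsq
  have hdist : ∑ k, (b k - b' k) ^ 2 = 0 :=
    le_antisymm (le_of_mul_le_mul_left (by linarith) hlamb) hsq
  refine ⟨funext fun k => ?_, le_antisymm hloss (by linarith)⟩
  have hk := (Finset.sum_eq_zero_iff_of_nonneg fun _ _ => sq_nonneg _).1 hdist k (Finset.mem_univ k)
  exact sub_eq_zero.1 (sq_eq_zero_iff.1 hk)

theorem eq_of_isMinOn_convexObjective (hlamZ : 0 < lamZ) (hlamb : 0 < lamb)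
    {p q : Matrix (Fin K) (Sample n) ℝ × (Fin K → ℝ)}
    (hp : IsMinOn (convexObjective n lamZ lamb) Set.univ p)
    (hq : IsMinOn (convexObjective n lamZ lamb) Set.univ q) : p = q := by
  obtain ⟨hb, hloss⟩ := midpoint_eq_of_isMinOn_convexObjective hlamZ hlamb hp hq
  refine Prod.ext (Matrix.ext fun l s => ?_) hb
  obtain ⟨c, hc⟩ := exists_eq_add_const_of_avgLoss_midpoint_eq hloss s
  have hcol (m : Fin K) : p.1 m s = q.1 m s + c := by linarith [hc m, congrFun hb m]
  have hsum := sum_eq_zero_of_isMinOn_convexObjective hlamZ hp s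
  simp only [hcol, Finset.sum_add_distrib, sum_eq_zero_of_isMinOn_convexObjective hlamZ hq s,
    Finset.sum_const, Finset.card_univ, Fintype.card_fin, nsmul_eq_mul, zero_add] at hsum
  have hK : (K : ℝ) ≠ 0 := Nat.cast_ne_zero.2 l.pos.ne'
  rw [hcol, (mul_eq_zero.1 hsum).resolve_left hK, add_zero]

theorem existsUnique_isMinOn_convexObjective (n : Fin K → ℕ) (hlamZ : 0 < lamZ)
    (hlamb : 0 < lamb) : ∃! p, IsMinOn (convexObjective n lamZ lamb) Set.univ p :=
  existsUnique_of_exists_of_unique (exists_isMinOn_convexObjective n hlamZ hlamb)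
    fun _ _ => eq_of_isMinOn_convexObjective hlamZ hlamb

theorem convexObjective_submatrix (Z : Matrix (Fin K) (Sample n) ℝ) (b : Fin K → ℝ)
    (τ : Equiv.Perm (Fin K)) (e : Equiv.Perm (Sample n)) (he : ∀ s, (e s).1 = τ s.1) :
    convexObjective n lamZ lamb (Z.submatrix τ e, b ∘ τ) = convexObjective n lamZ lamb (Z, b) := by
  simp only [convexObjective, avgLoss_submatrix Z b τ e he, nuclearNorm_submatrix,
    Function.comp_apply, Equiv.sum_comp τ fun k => b k ^ 2]

theorem submatrix_eq_of_isMinOn_convexObjective (hlamZ : 0 < lamZ) (hlamb : 0 < lamb)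
    {Z : Matrix (Fin K) (Sample n) ℝ} {b : Fin K → ℝ}
    (h : IsMinOn (convexObjective n lamZ lamb) Set.univ (Z, b)) (τ : Equiv.Perm (Fin K))
    (e : Equiv.Perm (Sample n)) (he : ∀ s, (e s).1 = τ s.1) :
    Z.submatrix τ e = Z ∧ b ∘ τ = b := by
  have h' : IsMinOn (convexObjective n lamZ lamb) Set.univ (Z.submatrix τ e, b ∘ τ) :=
    isMinOn_univ_iff.2 fun q =>
      (convexObjective_submatrix Z b τ e he).trans_le (isMinOn_univ_iff.1 h q)
  exact Prod.mk.inj (eq_of_isMinOn_convexObjective hlamZ hlamb h' h)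

end ConvexObjective

section ClusterInvariance

variable {ι α : Type*} {n : ι → α} {M N : Matrix ι ι ℝ}

open scoped MatrixOrder Matrix.Norms.L2Operator in
theorem posSemidef_eq_of_mul_self_eq [Fintype ι] (hM : M.PosSemidef)
    (hN : N.PosSemidef) (h : M * M = N * N) : M = N := by
  classical rw [← CFC.sqrt_unique h hM.nonneg, CFC.sqrt_unique rfl hN.nonneg]

/-- A matrix indexed by classes that is unchanged by every relabeling of the classes preserving
their sizes `n`. The sizes may take values in any type, since only their equality matters. -/
def ClusterInvariant (n : ι → α) (M : Matrix ι ι ℝ) : Prop :=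
  ∀ τ : Equiv.Perm ι, n ∘ τ = n → M.submatrix τ τ = M

namespace ClusterInvariant

theorem transpose (hM : ClusterInvariant n M) : ClusterInvariant n Mᵀ := fun τ hτ => by
  rw [← transpose_submatrix, hM τ hτ]

theorem mul [Fintype ι] (hM : ClusterInvariant n M) (hN : ClusterInvariant n N) :
    ClusterInvariant n (M * N) := fun τ hτ => by
  rw [submatrix_mul M N τ τ τ τ.bijective, hM τ hτ, hN τ hτ]

theorem diagonal_comp [DecidableEq ι] (n : ι → α) (f : α → ℝ) :
    ClusterInvariant n (diagonal (f ∘ n)) := fun τ hτ => by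
  rw [submatrix_diagonal_equiv, Function.comp_assoc, hτ]

theorem of_mul_self [Fintype ι] (hM : M.PosSemidef) (h : ClusterInvariant n (M * M)) :
    ClusterInvariant n M := fun τ hτ =>
  posSemidef_eq_of_mul_self_eq (hM.submatrix τ) hM <| by
    rw [← submatrix_mul M M τ τ τ τ.bijective, h τ hτ]

theorem diag_eq (hM : ClusterInvariant n M) {k k' : ι} (h : n k = n k') : M k k = M k' k' := by
  classical
  have := congrFun₂ (hM (Equiv.swap k k') (funext (Equiv.apply_swap_eq_self h))) k k
  simpa using this.symm

theorem offDiag_eq (hM : ClusterInvariant n M) {k k' l l' : ι} (hk : n k = n k') (hl : n l = n l')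
    (hkl : k ≠ l) (hkl' : k' ≠ l') : M k l = M k' l' := by
  classical
  set m := Equiv.swap k k' l
  have hm : n m = n l' := (Equiv.apply_swap_eq_self hk l).trans hl
  have hmk' : k' ≠ m := fun h =>
    hkl ((Equiv.swap k k').injective ((Equiv.swap_apply_left k k').trans h))
  have h₁ : M k' m = M k l := by
    simpa using congrFun₂ (hM (Equiv.swap k k') (funext (Equiv.apply_swap_eq_self hk))) k l
  have h₂ : M k' l' = M k' m := by
    simpa [Equiv.swap_apply_of_ne_of_ne hmk' hkl'] using
      congrFun₂ (hM (Equiv.swap m l') (funext (Equiv.apply_swap_eq_self hm))) k' m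
  rw [← h₁, h₂]

theorem exists_apply_eq [DecidableEq ι] (hM : ClusterInvariant n M) :
    ∃ (a : α → ℝ) (A : α → α → ℝ), ∀ k l,
      M k l = (if k = l then a (n k) else 0) + A (n k) (n l) := by
  obtain ⟨a, ha⟩ := (Function.factorsThrough_iff (f := n) fun k => M k k).1 fun _ _ => hM.diag_eq
  obtain ⟨A, hA⟩ := (Function.factorsThrough_iff
    (f := fun p : {p : ι × ι // p.1 ≠ p.2} => (n p.1.1, n p.1.2)) fun p => M p.1.1 p.1.2).1
    fun p q h => hM.offDiag_eq (Prod.mk.inj h).1 (Prod.mk.inj h).2 p.2 q.2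
  refine ⟨fun m => a m - A (m, m), fun m m' => A (m, m'), fun k l => ?_⟩
  split_ifs with hkl
  · rw [← hkl, sub_add_cancel]
    exact congrFun ha k
  · rw [zero_add]
    exact congrFun hA ⟨(k, l), hkl⟩

end ClusterInvariant

end ClusterInvariance

section Blocks

variable {K J : ℕ} {n : Fin K → ℕ} {Ns : Fin J → ℕ}

theorem indVec_cluster_apply (hNs : Function.Injective Ns) {k : Fin K} {j : Fin J}
    (hk : Ns j = n k) (i : Fin J) : indVec (cluster n (Ns i)) k = if i = j then 1 else 0 := by
  simp only [indVec, cluster, Finset.mem_filter, Finset.mem_univ, true_and, ← hk, hNs.eq_iff,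
    eq_comm]

theorem sum_indVec (s : Finset (Fin K)) : ∑ k, indVec s k = s.card := by
  simp [indVec]

theorem sum_smul_indVec_cluster_apply (hNs : Function.Injective Ns) {k : Fin K} {j : Fin J}
    (hk : Ns j = n k) (c : Fin J → ℝ) : (∑ i, c i • indVec (cluster n (Ns i))) k = c j := by
  simp [Finset.sum_apply, indVec_cluster_apply hNs hk]

theorem blockMatrix_apply (hNs : Function.Injective Ns) {k l : Fin K} {j j' : Fin J}
    (hk : Ns j = n k) (hl : Ns j' = n l) (a : Fin J → ℝ) (A : Fin J → Fin J → ℝ) :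
    blockMatrix n Ns a A k l = (if k = l then a j else 0) + A j j' := by
  simp only [blockMatrix, Matrix.add_apply, Matrix.sum_apply, Matrix.smul_apply, diagonal_apply,
    vecMulVec_apply, indVec_cluster_apply hNs hk, indVec_cluster_apply hNs hl, smul_eq_mul]
  congr 1
  · split_ifs <;> simp
  · simp

theorem sum_blockMatrix_apply (hNs : Function.Injective Ns) {k : Fin K} {j : Fin J}
    (hk : Ns j = n k) (a : Fin J → ℝ) (A : Fin J → Fin J → ℝ) :
    ∑ l, blockMatrix n Ns a A l k = a j + ∑ i, A i j * ((cluster n (Ns i)).card : ℝ) := by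
  simp only [blockMatrix, Matrix.add_apply, Matrix.sum_apply, Matrix.smul_apply, diagonal_apply,
    vecMulVec_apply, indVec_cluster_apply hNs hk, smul_eq_mul, Finset.sum_add_distrib]
  congr 1
  · rw [Finset.sum_comm]
    simp [indVec_cluster_apply hNs hk]
  · simp only [mul_ite, mul_one, mul_zero, Finset.sum_ite_eq', Finset.mem_univ, if_true,
      ← sum_indVec, Finset.mul_sum]
    exact Finset.sum_comm

theorem exists_eq_sum_smul_indVec {b : Fin K → ℝ} (hb : b.FactorsThrough n)
    (hNs : Function.Injective Ns) (hrange : Set.range Ns = Set.range n) :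
    ∃ c : Fin J → ℝ, b = ∑ j, c j • indVec (cluster n (Ns j)) := by
  obtain ⟨f, rfl⟩ := (Function.factorsThrough_iff b).1 hb
  refine ⟨f ∘ Ns, funext fun k => ?_⟩
  obtain ⟨j, hj⟩ : n k ∈ Set.range Ns := hrange ▸ Set.mem_range_self k
  rw [sum_smul_indVec_cluster_apply hNs hj, Function.comp_apply, Function.comp_apply, hj]

theorem ClusterInvariant.exists_eq_blockMatrix {M : Matrix (Fin K) (Fin K) ℝ}
    (hM : ClusterInvariant n M) (hNs : Function.Injective Ns)
    (hrange : Set.range Ns = Set.range n) :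
    ∃ (a : Fin J → ℝ) (A : Fin J → Fin J → ℝ), M = blockMatrix n Ns a A := by
  obtain ⟨a, A, hA⟩ := hM.exists_apply_eq
  refine ⟨a ∘ Ns, fun j j' => A (Ns j) (Ns j'), ?_⟩
  ext k l
  obtain ⟨j, hj⟩ : n k ∈ Set.range Ns := hrange ▸ Set.mem_range_self k
  obtain ⟨j', hj'⟩ : n l ∈ Set.range Ns := hrange ▸ Set.mem_range_self l
  rw [hA, blockMatrix_apply hNs hj hj', Function.comp_apply, hj, hj']

theorem add_sum_mul_card_cluster_eq_zero {a : Fin J → ℝ} {A : Fin J → Fin J → ℝ}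
    (hsum : ∀ k, ∑ l, blockMatrix n Ns a A l k = 0) (hNs : Function.Injective Ns)
    (hrange : Set.range Ns = Set.range n) (j : Fin J) :
    a j + ∑ j', A j' j * ((cluster n (Ns j')).card : ℝ) = 0 := by
  obtain ⟨k, hk⟩ : Ns j ∈ Set.range n := hrange ▸ Set.mem_range_self j
  rw [← sum_blockMatrix_apply hNs hk.symm, hsum]

theorem equalAngles_of_clusterInvariant {ι : Type*} [Fintype ι] {M : Matrix ι (Fin K) ℝ}
    (h : ClusterInvariant n (Mᵀ * M)) : EqualAngles n M := by
  intro m k hk l hl k' hk' l' hl' hkl hkl'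
  simp only [cluster, Finset.mem_filter, Finset.mem_univ, true_and] at hk hl hk' hl'
  have hnorm (k : Fin K) : ‖colVec M k‖ = √((Mᵀ * M) k k) := by
    rw [transpose_mul_apply_eq_inner, real_inner_self_eq_norm_sq, Real.sqrt_sq (norm_nonneg _)]
  simp only [InnerProductGeometry.angle, ← transpose_mul_apply_eq_inner, hnorm]
  rw [h.offDiag_eq (hk.trans hk'.symm) (hl.trans hl'.symm) hkl hkl',
    h.diag_eq (hk.trans hk'.symm), h.diag_eq (hl.trans hl'.symm)]

end Blocks

section Minimizer

variable {K : ℕ} {n : Fin K → ℕ} {lamZ lamb : ℝ} {Z : Matrix (Fin K) (Sample n) ℝ} {b : Fin K → ℝ}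

theorem mul_labels_apply {ι : Type*} (M : Matrix ι (Fin K) ℝ) (l : ι) (s : Sample n) :
    (M * labels n) l s = M l s.1 := by
  simp [mul_apply, labels]

theorem sum_classMean_eq_zero (h : ∀ s, ∑ l, Z l s = 0) (k : Fin K) :
    ∑ l, classMean n Z l k = 0 := by
  simp only [classMean, of_apply, ← Finset.mul_sum]
  rw [Finset.sum_comm, Finset.sum_eq_zero fun i _ => h ⟨k, i⟩, mul_zero]

theorem eq_classMean_of_isMinOn (hlamZ : 0 < lamZ) (hlamb : 0 < lamb)
    (h : IsMinOn (convexObjective n lamZ lamb) Set.univ (Z, b)) (k : Fin K) (i : Fin (n k))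
    (l : Fin K) : Z l ⟨k, i⟩ = classMean n Z l k := by
  have hi (i' : Fin (n k)) : Z l ⟨k, i'⟩ = Z l ⟨k, i⟩ := by
    have hswap (s : Sample n) : (Equiv.swap (⟨k, i⟩ : Sample n) ⟨k, i'⟩ s).1 = s.1 :=
      Equiv.apply_swap_eq_self (v := Sigma.fst) (i := ⟨k, i⟩) (j := ⟨k, i'⟩) rfl s
    have := (submatrix_eq_of_isMinOn_convexObjective hlamZ hlamb h 1 _ hswap).1
    simpa using congrFun₂ this l ⟨k, i⟩
  have hnk : (n k : ℝ) ≠ 0 := Nat.cast_ne_zero.2 i.pos.ne'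
  simp only [classMean, of_apply, hi, Finset.sum_const, Finset.card_univ, Fintype.card_fin,
    nsmul_eq_mul, one_div, inv_mul_cancel_left₀ hnk]

theorem eq_classMean_mul_labels_of_isMinOn (hlamZ : 0 < lamZ) (hlamb : 0 < lamb)
    (h : IsMinOn (convexObjective n lamZ lamb) Set.univ (Z, b)) : Z = classMean n Z * labels n := by
  ext l s
  rw [mul_labels_apply]
  exact eq_classMean_of_isMinOn hlamZ hlamb h s.1 s.2 l

/-- The relabeling of the samples, keeping their number within the class, that is induced by a
size-preserving relabeling `τ` of the classes. -/
def samplePerm (τ : Equiv.Perm (Fin K)) (hτ : n ∘ τ = n) : Equiv.Perm (Sample n) :=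
  Equiv.sigmaCongr τ fun k => finCongr (congrFun hτ k).symm

theorem classMean_submatrix (Z : Matrix (Fin K) (Sample n) ℝ) (τ : Equiv.Perm (Fin K))
    (hτ : n ∘ τ = n) :
    classMean n (Z.submatrix τ (samplePerm τ hτ)) = (classMean n Z).submatrix τ τ := by
  ext l k
  have hk : n (τ k) = n k := congrFun hτ k
  simp only [classMean, of_apply, submatrix_apply, hk,
    ← Equiv.sum_comp (finCongr hk.symm) fun i => Z (τ l) ⟨τ k, i⟩]
  rfl

theorem clusterInvariant_classMean_of_isMinOn (hlamZ : 0 < lamZ) (hlamb : 0 < lamb)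
    (h : IsMinOn (convexObjective n lamZ lamb) Set.univ (Z, b)) :
    ClusterInvariant n (classMean n Z) := fun τ hτ => by
  rw [← classMean_submatrix Z τ hτ,
    (submatrix_eq_of_isMinOn_convexObjective hlamZ hlamb h τ (samplePerm τ hτ) fun _ => rfl).1]

theorem factorsThrough_of_isMinOn (hlamZ : 0 < lamZ) (hlamb : 0 < lamb)
    (h : IsMinOn (convexObjective n lamZ lamb) Set.univ (Z, b)) : b.FactorsThrough n := by
  intro k l hkl
  have hswap : n ∘ Equiv.swap k l = n := funext (Equiv.apply_swap_eq_self hkl)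
  simpa using congrFun
    (submatrix_eq_of_isMinOn_convexObjective hlamZ hlamb h _ (samplePerm _ hswap) fun _ => rfl).2 l

end Minimizer

section Scalar

variable {κ q x y : ℝ}

theorem log_exp_add_tangent_lt (hκ : 0 < κ) (hxy : x ≠ y) :
    Real.log (Real.exp x + κ) + Real.exp x / (Real.exp x + κ) * (y - x) <
      Real.log (Real.exp y + κ) := by
  have hx := Real.exp_pos x
  have hE : 0 < Real.exp x + κ := add_pos hx hκ
  have hconv := strictConvexOn_exp.2 (Set.mem_univ (y - x)) (Set.mem_univ 0)
    (sub_ne_zero.2 hxy.symm) (div_pos hx hE) (div_pos hκ hE)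
    (by rw [← add_div, div_self hE.ne'])
  simp only [smul_eq_mul, mul_zero, add_zero, Real.exp_zero, mul_one] at hconv
  have hexp : Real.exp y + κ = (Real.exp x + κ) *
      (Real.exp x / (Real.exp x + κ) * Real.exp (y - x) + κ / (Real.exp x + κ)) := by
    rw [Real.exp_sub]
    field_simp
  rw [hexp, Real.log_mul hE.ne' ((Real.exp_pos _).trans hconv).ne']
  gcongr
  exact (Real.lt_log_iff_exp_lt ((Real.exp_pos _).trans hconv)).2 hconv

/-- `hslope` and `hcompl` are the first-order optimality conditions at `x`. -/
theorem log_exp_add_sub_add_abs_lt (hκ : 0 < κ) (hx : 0 ≤ x) (hslope : 1 ≤ q * (Real.exp x + κ))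
    (hcompl : (q * (Real.exp x + κ) - 1) * x = 0) (hxy : x ≠ y) :
    Real.log (Real.exp x + κ) - x + κ * q * |x| < Real.log (Real.exp y + κ) - y + κ * q * |y| := by
  have hE : 0 < Real.exp x + κ := add_pos (Real.exp_pos x) hκ
  have htangent := log_exp_add_tangent_lt hκ hxy
  have hweight : Real.exp x / (Real.exp x + κ) = 1 - κ * (Real.exp x + κ)⁻¹ := by
    field_simp
    ring
  have hq : (Real.exp x + κ)⁻¹ ≤ q := by
    rwa [inv_eq_one_div, div_le_iff₀ hE]
  have hy : (Real.exp x + κ)⁻¹ * y ≤ q * |y| :=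
    (mul_le_mul_of_nonneg_left (le_abs_self y) (inv_pos.2 hE).le).trans
      (mul_le_mul_of_nonneg_right hq (abs_nonneg y))
  have hxq : (Real.exp x + κ)⁻¹ * x = q * x := by
    field_simp
    linarith
  rw [abs_of_nonneg hx]
  rw [hweight] at htangent
  linarith [mul_le_mul_of_nonneg_left hy hκ.le, congrArg (κ * ·) hxq]

/-- The coefficient of `K I - J` in the minimizer for `K` classes of size `N / K`. It vanishes as
soon as the regularization dominates the gradient of the loss at `Z = 0`. -/
noncomputable def balancedCoeff (K : ℕ) (N lamZ : ℝ) : ℝ :=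
  if √(N / K) ≤ N * lamZ then 0 else 1 / K * Real.log (√K / (√N * lamZ) - K + 1)

theorem balancedCoeff_optimality {K : ℕ} (hK : 0 < K) {m lamZ : ℝ} (hm : 0 < m)
    (hlamZ : 0 < lamZ) (hx : x = balancedCoeff K (K * m) lamZ * K) (hq : q = lamZ * √m) :
    0 ≤ x ∧ 1 ≤ q * (Real.exp x + (K - 1)) ∧ (q * (Real.exp x + (K - 1)) - 1) * x = 0 := by
  have hK' : (0 : ℝ) < K := Nat.cast_pos.2 hK
  have hq0 : 0 < q := hq ▸ mul_pos hlamZ (Real.sqrt_pos.2 hm)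
  have hthreshold : √(K * m / K) ≤ K * m * lamZ ↔ 1 ≤ q * K := by
    have hfactor : K * m * lamZ = √m * (q * K) := by
      rw [hq]
      linear_combination -(K * lamZ) * Real.mul_self_sqrt hm.le
    rw [mul_div_cancel_left₀ m hK'.ne', hfactor, le_mul_iff_one_le_right (Real.sqrt_pos.2 hm)]
  have hquotient : √K / (√(K * m) * lamZ) = 1 / q := by
    have := Real.sqrt_pos.2 hK'
    rw [hq, Real.sqrt_mul hK'.le]
    field_simp
  simp only [balancedCoeff, hthreshold, hquotient] at hx
  split_ifs at hx with h
  · rw [zero_mul] at hx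
    simp [hx, h]
  · have hK_lt : (K : ℝ) < 1 / q := (lt_div_iff₀' hq0).2 (not_le.1 h)
    have hx' : x = Real.log (1 / q - K + 1) := by
      rw [hx]
      field_simp
    have hexp : q * (Real.exp x + (K - 1)) = 1 := by
      rw [hx', Real.exp_log (by linarith)]
      field_simp
      ring
    exact ⟨hx' ▸ Real.log_nonneg (by linarith), hexp.ge, by rw [hexp, sub_self, zero_mul]⟩

end Scalar

section NormalizedLabels

variable {K : ℕ} {n : Fin K → ℕ}

/-- `D^{-1/2} Y`, the label matrix with its rows scaled to unit length. -/
noncomputable def normalizedLabels (n : Fin K → ℕ) : Matrix (Fin K) (Sample n) ℝ :=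
  diagonal (fun k => (√(n k : ℝ))⁻¹) * labels n

theorem diagonal_sqrt_mul_diagonal_inv (hn : ∀ k, 0 < n k) :
    diagonal (fun k => √(n k : ℝ)) * diagonal (fun k => (√(n k : ℝ))⁻¹) = 1 := by
  rw [diagonal_mul_diagonal, ← diagonal_one]
  congr! with k
  exact mul_inv_cancel₀ (Real.sqrt_pos.2 (Nat.cast_pos.2 (hn k))).ne'

theorem diagonal_mul_normalizedLabels (hn : ∀ k, 0 < n k) :
    diagonal (fun k => √(n k : ℝ)) * normalizedLabels n = labels n := by
  rw [normalizedLabels, ← Matrix.mul_assoc, diagonal_sqrt_mul_diagonal_inv hn, Matrix.one_mul]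

theorem labels_mul_transpose : labels n * (labels n)ᵀ = diagonal fun k => (n k : ℝ) := by
  ext k l
  simp only [mul_apply, Fintype.sum_sigma, labels, transpose_apply, of_apply, diagonal_apply]
  split_ifs with h <;> simp [h]

theorem normalizedLabels_mul_transpose (hn : ∀ k, 0 < n k) :
    normalizedLabels n * (normalizedLabels n)ᵀ = 1 := by
  rw [normalizedLabels, transpose_mul, diagonal_transpose, Matrix.mul_assoc,
    ← Matrix.mul_assoc (labels n), labels_mul_transpose, diagonal_mul_diagonal,
    diagonal_mul_diagonal, ← diagonal_one]
  congr! with k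
  have hk : (0 : ℝ) < n k := Nat.cast_pos.2 (hn k)
  rw [← div_eq_mul_inv, Real.div_sqrt, inv_mul_cancel₀ (Real.sqrt_pos.2 hk).ne']

end NormalizedLabels

section Balanced

variable {K m : ℕ} {n : Fin K → ℕ} {lamZ lamb : ℝ} {Z : Matrix (Fin K) (Sample n) ℝ}
  {b : Fin K → ℝ}

/-- The matrix `K I - J`, whose columns are the vertices of a regular simplex. -/
def simplexMatrix (K : ℕ) : Matrix (Fin K) (Fin K) ℝ :=
  (K : ℝ) • (1 : Matrix (Fin K) (Fin K) ℝ) - of fun _ _ => 1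

theorem simplexMatrix_eq_smul_centering : simplexMatrix K = (K : ℝ) • centering (Fin K) := by
  ext k l
  have hK : (K : ℝ) ≠ 0 := Nat.cast_ne_zero.2 k.pos.ne'
  simp [simplexMatrix, centering, mul_sub, hK]

theorem frobSq_centering (hK : 0 < K) : frobSq (centering (Fin K)) = K - 1 := by
  have hK' : (K : ℝ) ≠ 0 := Nat.cast_ne_zero.2 hK.ne'
  rw [frobSq_eq_trace, isSymm_centering, isIdempotentElem_centering]
  simp [centering, trace, hK']

theorem nuclearNorm_simplexMatrix_mul_labels (hK : 0 < K) (hm : 0 < m) (h : ∀ k, n k = m) :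
    nuclearNorm (simplexMatrix K * labels n) = K * √m * (K - 1) := by
  have hlabels : labels n = √(m : ℝ) • normalizedLabels n := by
    simp only [← diagonal_mul_normalizedLabels fun k => (h k).symm ▸ hm, h, ← smul_eq_diagonal_mul]
  have hisometry : (normalizedLabels n)ᵀᵀ * (normalizedLabels n)ᵀ = 1 :=
    normalizedLabels_mul_transpose fun k => (h k).symm ▸ hm
  have hgram := nuclearNorm_mul_gram_mul_transpose (U := (1 : Matrix (Fin K) (Fin K) ℝ)) (by simp)
    hisometry (centering (Fin K))
  rw [Matrix.one_mul, isSymm_centering, isIdempotentElem_centering, transpose_transpose,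
    frobSq_centering hK] at hgram
  rw [simplexMatrix_eq_smul_centering, hlabels, Matrix.smul_mul, Matrix.mul_smul, nuclearNorm_smul,
    nuclearNorm_smul, hgram, abs_of_nonneg (Nat.cast_nonneg K), abs_of_nonneg (Real.sqrt_nonneg _),
    mul_assoc]

theorem crossEntropy_ite (x : ℝ) (k : Fin K) :
    crossEntropy (fun l => if l = k then x else 0) k = Real.log (Real.exp x + (K - 1)) - x := by
  have hexp (l : Fin K) : Real.exp (if l = k then x else 0) =
      (if l = k then Real.exp x - 1 else 0) + 1 := by
    split_ifs <;> simp
  simp only [crossEntropy, hexp, Finset.sum_add_distrib, Finset.sum_ite_eq', Finset.mem_univ,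
    if_true, Finset.sum_const, Finset.card_univ, Fintype.card_fin, nsmul_eq_mul, mul_one]
  ring_nf

theorem avgLoss_eq_of_forall {c : ℝ} (hN : total n ≠ 0)
    (h : ∀ s : Sample n, crossEntropy (fun l => Z l s + b l) s.1 = c) : avgLoss n Z b = c := by
  rw [avgLoss_eq, Finset.sum_congr rfl fun s _ => h s, Finset.sum_const, Finset.card_univ,
    Fintype.card_sigma, nsmul_eq_mul]
  simp only [Fintype.card_fin, Nat.cast_sum]
  rw [← total, one_div, inv_mul_cancel_left₀ hN]

theorem avgLoss_simplexMatrix (hN : total n ≠ 0) (t : ℝ) :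
    avgLoss n (t • (simplexMatrix K * labels n)) 0 =
      Real.log (Real.exp (t * K) + (K - 1)) - t * K := by
  refine avgLoss_eq_of_forall hN fun s => ?_
  rw [← crossEntropy_ite, ← crossEntropy_add_const (fun l => if l = s.1 then t * K else 0) (-t)]
  congr! 2 with l
  rw [Matrix.smul_apply, mul_labels_apply]
  simp only [simplexMatrix, Matrix.sub_apply, Matrix.smul_apply, one_apply, of_apply,
    Pi.zero_apply, smul_eq_mul]
  split_ifs <;> ring

theorem convexObjective_simplexMatrix (hK : 0 < K) (hm : 0 < m) (h : ∀ k, n k = m) (t : ℝ) :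
    convexObjective n lamZ lamb (t • (simplexMatrix K * labels n), 0) =
      Real.log (Real.exp (t * K) + (K - 1)) - t * K + (K - 1) * (lamZ * √m) * |t * K| := by
  have hN : total n ≠ 0 := by
    simp [total, h, hK.ne', hm.ne']
  simp only [convexObjective, avgLoss_simplexMatrix hN, nuclearNorm_smul,
    nuclearNorm_simplexMatrix_mul_labels hK hm h, Pi.zero_apply, abs_mul, Nat.abs_cast]
  simp only [ne_eq, OfNat.ofNat_ne_zero, not_false_eq_true, zero_pow, Finset.sum_const_zero]
  ring

theorem exists_eq_smul_simplexMatrix {M : Matrix (Fin K) (Fin K) ℝ} (hM : ClusterInvariant n M)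
    (h : ∀ k, n k = m) (hsum : ∀ k, ∑ l, M l k = 0) : ∃ t : ℝ, M = t • simplexMatrix K := by
  obtain ⟨a, A, hA⟩ := hM.exists_apply_eq
  simp only [h] at hA
  refine ⟨-A m m, ?_⟩
  ext k l
  have hk := hsum k
  simp only [hA, Finset.sum_add_distrib, Finset.sum_ite_eq', Finset.mem_univ, if_true,
    Finset.sum_const, Finset.card_univ, Fintype.card_fin, nsmul_eq_mul] at hk
  simp only [hA, simplexMatrix, Matrix.sub_apply, Matrix.smul_apply, one_apply, of_apply,
    smul_eq_mul]
  split_ifs <;> linarith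

theorem eq_zero_of_isMinOn_of_const (hlamb : 0 < lamb)
    (h : IsMinOn (convexObjective n lamZ lamb) Set.univ (Z, b)) (hb : ∀ k l, b k = b l) :
    b = 0 := by
  ext k
  have hmin := isMinOn_univ_iff.1 h (Z, 0)
  have hloss : avgLoss n Z b = avgLoss n Z 0 :=
    avgLoss_congr_of_add_const (fun _ => b k) fun l s => by simp [hb l k]
  simp only [convexObjective, hloss, Pi.zero_apply] at hmin
  have hsum : lamb / 2 * ∑ k, b k ^ 2 ≤ 0 := by simpa using hmin
  have := (Finset.sum_eq_zero_iff_of_nonneg fun k _ => sq_nonneg (b k)).1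
    ((nonpos_of_mul_nonpos_right hsum (half_pos hlamb)).antisymm (by positivity)) k
    (Finset.mem_univ k)
  exact sq_eq_zero_iff.1 this

theorem classMean_eq_of_isMinOn_of_balanced (hlamZ : 0 < lamZ) (hlamb : 0 < lamb) (hm : 0 < m)
    (hn : ∀ k, n k = m) (h : IsMinOn (convexObjective n lamZ lamb) Set.univ (Z, b)) :
    b = 0 ∧ classMean n Z = balancedCoeff K (total n) lamZ • simplexMatrix K := by
  have hb : b = 0 := eq_zero_of_isMinOn_of_const hlamb h fun k l =>
    factorsThrough_of_isMinOn hlamZ hlamb h ((hn k).trans (hn l).symm)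
  obtain ⟨t, ht⟩ := exists_eq_smul_simplexMatrix
    (clusterInvariant_classMean_of_isMinOn hlamZ hlamb h) hn
    (sum_classMean_eq_zero (sum_eq_zero_of_isMinOn_convexObjective hlamZ h))
  refine ⟨hb, ?_⟩
  rcases le_or_gt K 1 with hK | hK
  · have hsimplex : simplexMatrix K = 0 := by
      ext k l
      obtain rfl : K = 1 := hK.antisymm k.pos
      simp [simplexMatrix, Subsingleton.elim k l]
    rw [ht, hsimplex, smul_zero, smul_zero]
  have hK0 : 0 < K := hK.pos
  have hK' : (1 : ℝ) < K := Nat.one_lt_cast.2 hK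
  rw [eq_classMean_mul_labels_of_isMinOn hlamZ hlamb h, ht, Matrix.smul_mul, hb] at h
  have hN : total n = K * m := by simp [total, hn]
  obtain ⟨hnonneg, hslope, hcompl⟩ := balancedCoeff_optimality hK0 (Nat.cast_pos.2 hm) hlamZ rfl rfl
  have hmin := isMinOn_univ_iff.1 h (balancedCoeff K (K * m) lamZ • (simplexMatrix K * labels n), 0)
  simp only [convexObjective_simplexMatrix hK0 hm hn] at hmin
  have hcoeff : balancedCoeff K (K * m) lamZ * K = t * K := by
    by_contra hne
    exact hmin.not_gt (log_exp_add_sub_add_abs_lt (sub_pos.2 hK') hnonneg hslope hcompl hne)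
  rw [ht, hN, mul_right_cancel₀ (by positivity) hcoeff]

end Balanced

section OptimalFactorization

variable {ι κ μ ν : Type*} [Fintype ι] [Fintype κ] [Fintype μ] [Fintype ν] [DecidableEq ν]

theorem exists_isometry_of_orthonormal_restrict (hcard : Fintype.card ν ≤ Fintype.card μ)
    {N : Matrix μ ν ℝ} {s : Set ν} (hN : Orthonormal ℝ (s.domRestrict (colVec N))) :
    ∃ Q : Matrix μ ν ℝ, Qᵀ * Q = 1 ∧ ∀ k ∈ s, colVec Q k = colVec N k := by
  classical
  obtain ⟨e⟩ := Function.Embedding.nonempty_of_card_le hcard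
  have hv : Orthonormal ℝ ((e '' s).domRestrict (Function.extend e (colVec N) 0)) := by
    rw [orthonormal_iff_ite]
    rintro ⟨_, k, hk, rfl⟩ ⟨_, l, hl, rfl⟩
    simpa [Subtype.ext_iff, e.injective.extend_apply] using
      orthonormal_iff_ite.1 hN ⟨k, hk⟩ ⟨l, hl⟩
  obtain ⟨B, hB⟩ := hv.exists_orthonormalBasis_extension_of_card_eq (by simp)
  refine ⟨of fun i k => B (e k) i, orthonormal_colVec_iff.1 (B.orthonormal.comp e e.injective),
    fun k hk => ?_⟩
  exact (hB (e k) (Set.mem_image_of_mem e hk)).trans (e.injective.extend_apply _ _ k)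

theorem exists_isometry_mul_diagonal_eq (hcard : Fintype.card ν ≤ Fintype.card μ)
    {M : Matrix μ ν ℝ} {d : ν → ℝ} (hM : Mᵀ * M = diagonal fun k => d k ^ 2) :
    ∃ Q : Matrix μ ν ℝ, Qᵀ * Q = 1 ∧ Q * diagonal d = M := by
  have hinner (k l : ν) : inner ℝ (colVec M k) (colVec M l) = if k = l then d k ^ 2 else 0 := by
    rw [← transpose_mul_apply_eq_inner, hM, diagonal_apply]
  have hcol (k : ν) : colVec (M * diagonal d⁻¹) k = (d k)⁻¹ • colVec M k := by
    ext i
    simp [colVec, mul_comm]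
  have horth : Orthonormal ℝ ({k | d k ≠ 0}.domRestrict (colVec (M * diagonal d⁻¹))) := by
    rw [orthonormal_iff_ite]
    rintro ⟨k, hk : d k ≠ 0⟩ ⟨l, hl⟩
    simp only [Set.domRestrict_apply, hcol, real_inner_smul_left, real_inner_smul_right, hinner,
      Subtype.mk.injEq]
    split_ifs with hkl
    · subst hkl
      field_simp
    · simp
  obtain ⟨Q, hQ, hQN⟩ := exists_isometry_of_orthonormal_restrict hcard horth
  refine ⟨Q, hQ, ?_⟩
  ext i k
  rw [mul_diagonal]
  change colVec Q k i * d k = colVec M k i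
  rcases eq_or_ne (d k) 0 with hk | hk
  · have hMk : colVec M k = 0 := inner_self_eq_zero.1 ((hinner k k).trans (by simp [hk]))
    simp [hk, hMk]
  · rw [hQN k hk, hcol, PiLp.smul_apply, smul_eq_mul, mul_comm, mul_inv_cancel_left₀ hk]

theorem exists_isometry (hcard : Fintype.card ν ≤ Fintype.card μ) :
    ∃ Q : Matrix μ ν ℝ, Qᵀ * Q = 1 := by
  obtain ⟨Q, hQ, -⟩ := exists_isometry_mul_diagonal_eq (M := (0 : Matrix μ ν ℝ)) (d := 0) hcard
    (by simp)
  exact ⟨Q, hQ⟩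

variable {U : Matrix ι ν ℝ} {V : Matrix κ ν ℝ} {σ : ν → ℝ}

theorem nuclearNorm_mul_diagonal_mul_transpose [DecidableEq κ] (hU : Uᵀ * U = 1) (hV : Vᵀ * V = 1)
    (hσ : ∀ i, 0 ≤ σ i) : nuclearNorm (U * diagonal σ * Vᵀ) = ∑ i, σ i := by
  have h := nuclearNorm_mul_gram_mul_transpose hU hV (balancedFactor σ (1 : Matrix ν ν ℝ))
  rwa [transpose_balancedFactor_mul hσ, Matrix.one_mul, transpose_one, Matrix.mul_one,
    frobSq_balancedFactor hσ (by simp)] at h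

theorem transpose_mul_isometry_mul [DecidableEq ι] {Q : Matrix μ ι ℝ} (hQ : Qᵀ * Q = 1)
    {α β : Type*} (A : Matrix ι α ℝ) (B : Matrix ι β ℝ) : (Q * A)ᵀ * (Q * B) = Aᵀ * B := by
  rw [transpose_mul, Matrix.mul_assoc, ← Matrix.mul_assoc Qᵀ, hQ, Matrix.one_mul]

theorem isOptimalFactorization_iff [DecidableEq κ] (hcard : Fintype.card ν ≤ Fintype.card μ)
    (hU : Uᵀ * U = 1) (hV : Vᵀ * V = 1) (hσ : ∀ i, 0 ≤ σ i) {A : Matrix ι κ ℝ}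
    (hA : A = U * diagonal σ * Vᵀ) {W : Matrix μ ι ℝ} {H : Matrix μ κ ℝ} :
    Wᵀ * H = A ∧ (frobSq W + frobSq H) / 2 = nuclearNorm A ↔
      ∃ Q : Matrix μ ν ℝ, Qᵀ * Q = 1 ∧ W = Q * balancedFactor σ U ∧
        H = Q * balancedFactor σ V := by
  have hN : nuclearNorm A = ∑ i, σ i := hA ▸ nuclearNorm_mul_diagonal_mul_transpose hU hV hσ
  constructor
  · rintro ⟨hWH, hopt⟩
    have hdiag : Uᵀ * (Wᵀ * H) * V = diagonal σ := by
      rw [hWH, hA, Matrix.mul_assoc, Matrix.mul_assoc _ Vᵀ, hV, Matrix.mul_one, ← Matrix.mul_assoc,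
        hU, Matrix.one_mul]
    obtain ⟨hWU, hW, hH⟩ := eq_mul_of_trace_eq_of_partialIsometry
      (by rw [Matrix.mul_assoc, hU, Matrix.mul_one] : U * Uᵀ * U = U)
      (by rw [Matrix.mul_assoc, hV, Matrix.mul_one] : V * Vᵀ * V = V)
      (by rw [hdiag, trace_diagonal, ← hN, ← hopt])
    have hgram : (W * U)ᵀ * (W * U) = diagonal fun i => √(σ i) ^ 2 := by
      nth_rewrite 2 [hWU]
      simp only [Real.sq_sqrt (hσ _), ← hdiag, transpose_mul, Matrix.mul_assoc]
    obtain ⟨Q, hQ, hQW⟩ := exists_isometry_mul_diagonal_eq hcard hgram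
    refine ⟨Q, hQ, ?_, ?_⟩
    · rw [balancedFactor, ← Matrix.mul_assoc, hQW, Matrix.mul_assoc, ← hW]
    · rw [balancedFactor, ← Matrix.mul_assoc, hQW, hWU, Matrix.mul_assoc, ← hH]
  · rintro ⟨Q, hQ, rfl, rfl⟩
    rw [transpose_mul_isometry_mul hQ, transpose_balancedFactor_mul hσ, hA,
      frobSq_mul_of_transpose_mul_self hQ, frobSq_mul_of_transpose_mul_self hQ,
      frobSq_balancedFactor hσ (by rw [hU, Matrix.one_mul]),
      frobSq_balancedFactor hσ (by rw [hV, Matrix.one_mul]), add_self_div_two, ← hA, hN]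
    exact ⟨rfl, rfl⟩

end OptimalFactorization

section FactorizedObjective

variable {K d : ℕ} {n : Fin K → ℕ} {lamZ lamb lamW lamH : ℝ}

theorem factorizedObjective_eq_convexObjective_add (W : Matrix (Fin d) (Fin K) ℝ)
    (H : Matrix (Fin d) (Sample n) ℝ) (b : Fin K → ℝ) :
    factorizedObjective n lamZ lamZ lamb d (W, H, b) = convexObjective n lamZ lamb (Wᵀ * H, b) +
      lamZ * ((frobSq W + frobSq H) / 2 - nuclearNorm (Wᵀ * H)) := by
  simp only [factorizedObjective, convexObjective]
  ring

theorem convexObjective_le_factorizedObjective (hlamZ : 0 ≤ lamZ) (W : Matrix (Fin d) (Fin K) ℝ)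
    (H : Matrix (Fin d) (Sample n) ℝ) (b : Fin K → ℝ) :
    convexObjective n lamZ lamb (Wᵀ * H, b) ≤
      factorizedObjective n lamZ lamZ lamb d (W, H, b) := by
  rw [factorizedObjective_eq_convexObjective_add]
  exact le_add_of_nonneg_right (mul_nonneg hlamZ (sub_nonneg.2 (nuclearNorm_le W H)))

theorem isMinOn_factorizedObjective_iff_isOptimalFactorization (hlamZ : 0 < lamZ)
    (hlamb : 0 < lamb) {Z : Matrix (Fin K) (Sample n) ℝ} {b : Fin K → ℝ}
    (h : IsMinOn (convexObjective n lamZ lamb) Set.univ (Z, b))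
    (hattained : ∃ (W₀ : Matrix (Fin d) (Fin K) ℝ) (H₀ : Matrix (Fin d) (Sample n) ℝ),
      W₀ᵀ * H₀ = Z ∧ (frobSq W₀ + frobSq H₀) / 2 = nuclearNorm Z)
    {W : Matrix (Fin d) (Fin K) ℝ} {H : Matrix (Fin d) (Sample n) ℝ} {b' : Fin K → ℝ} :
    IsMinOn (factorizedObjective n lamZ lamZ lamb d) Set.univ (W, H, b') ↔
      b' = b ∧ Wᵀ * H = Z ∧ (frobSq W + frobSq H) / 2 = nuclearNorm Z := by
  have heq {X : Matrix (Fin d) (Fin K) ℝ} {Y : Matrix (Fin d) (Sample n) ℝ} (hXY : Xᵀ * Y = Z)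
      (hopt : (frobSq X + frobSq Y) / 2 = nuclearNorm Z) :
      factorizedObjective n lamZ lamZ lamb d (X, Y, b) = convexObjective n lamZ lamb (Z, b) := by
    rw [factorizedObjective_eq_convexObjective_add, hXY, hopt, sub_self, mul_zero, add_zero]
  constructor
  · intro hmin
    obtain ⟨W₀, H₀, hZ₀, hN₀⟩ := hattained
    have hle := (isMinOn_univ_iff.1 hmin (W₀, H₀, b)).trans_eq (heq hZ₀ hN₀)
    have hconvex : IsMinOn (convexObjective n lamZ lamb) Set.univ (Wᵀ * H, b') := fun q hq =>
      ((convexObjective_le_factorizedObjective hlamZ.le W H b').trans hle).trans (h hq)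
    obtain ⟨hZ, hb⟩ := Prod.mk_inj.1 (eq_of_isMinOn_convexObjective hlamZ hlamb hconvex h)
    refine ⟨hb, hZ, le_antisymm ?_ (hZ ▸ nuclearNorm_le W H)⟩
    rw [factorizedObjective_eq_convexObjective_add, hZ, hb, add_le_iff_nonpos_right] at hle
    exact sub_nonpos.1 (nonpos_of_mul_nonpos_right hle hlamZ)
  · rintro ⟨rfl, hZ, hN⟩ ⟨X, Y, c⟩ -
    exact ((heq hZ hN).trans_le (isMinOn_univ_iff.1 h (Xᵀ * Y, c))).trans
      (convexObjective_le_factorizedObjective hlamZ.le X Y c)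

theorem factorizedObjective_smul {c : ℝ} (hc : c ≠ 0) (W : Matrix (Fin d) (Fin K) ℝ)
    (H : Matrix (Fin d) (Sample n) ℝ) (b : Fin K → ℝ) :
    factorizedObjective n lamW lamH lamb d (c • W, c⁻¹ • H, b) =
      factorizedObjective n (c ^ 2 * lamW) (c⁻¹ ^ 2 * lamH) lamb d (W, H, b) := by
  have hmul : (c • W)ᵀ * (c⁻¹ • H) = Wᵀ * H := by
    rw [transpose_smul, Matrix.smul_mul, Matrix.mul_smul, smul_inv_smul₀ hc]
  simp only [factorizedObjective, hmul, frobSq_smul]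
  ring

theorem isMinOn_factorizedObjective_smul_iff {c : ℝ} (hc : c ≠ 0) {W : Matrix (Fin d) (Fin K) ℝ}
    {H : Matrix (Fin d) (Sample n) ℝ} {b : Fin K → ℝ} :
    IsMinOn (factorizedObjective n lamW lamH lamb d) Set.univ (c • W, c⁻¹ • H, b) ↔
      IsMinOn (factorizedObjective n (c ^ 2 * lamW) (c⁻¹ ^ 2 * lamH) lamb d) Set.univ
        (W, H, b) := by
  simp only [isMinOn_univ_iff, Prod.forall, ← factorizedObjective_smul hc]
  refine ⟨fun h X Y e => h _ _ _, fun h X Y e => ?_⟩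
  simpa only [smul_inv_smul₀ hc, inv_smul_smul₀ hc] using h (c⁻¹ • X) (c • Y) e

theorem rpow_quarter_sq_mul_sqrt {x y : ℝ} (hx : 0 < x) (hy : 0 < y) :
    ((x / y) ^ (1 / 4 : ℝ)) ^ 2 * √(x * y) = x := by
  have hsq : ((x / y) ^ (1 / 4 : ℝ)) ^ 2 = √(x / y) := by
    rw [Real.sqrt_eq_rpow, ← Real.rpow_natCast, ← Real.rpow_mul (by positivity)]
    norm_num
  have hxy : x / y * (x * y) = x * x := by field_simp
  rw [hsq, ← Real.sqrt_mul (by positivity), hxy, Real.sqrt_mul_self hx.le]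

theorem isMinOn_factorizedObjective_iff (hlamb : 0 < lamb) (hlamW : 0 < lamW) (hlamH : 0 < lamH)
    {Z : Matrix (Fin K) (Sample n) ℝ} {b : Fin K → ℝ}
    (h : IsMinOn (convexObjective n √(lamW * lamH) lamb) Set.univ (Z, b)) (hd : K ≤ d)
    {U : Matrix (Fin K) (Fin K) ℝ} {V : Matrix (Sample n) (Fin K) ℝ} {σ : Fin K → ℝ}
    (hU : Uᵀ * U = 1) (hV : Vᵀ * V = 1) (hσ : ∀ k, 0 ≤ σ k) (hZ : Z = U * diagonal σ * Vᵀ)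
    {W : Matrix (Fin d) (Fin K) ℝ} {H : Matrix (Fin d) (Sample n) ℝ} {b' : Fin K → ℝ} :
    IsMinOn (factorizedObjective n lamW lamH lamb d) Set.univ (W, H, b') ↔
      b' = b ∧ ∃ Q : Matrix (Fin d) (Fin K) ℝ, Qᵀ * Q = 1 ∧
        W = (lamH / lamW) ^ (1 / 4 : ℝ) • (Q * balancedFactor σ U) ∧
        H = (lamW / lamH) ^ (1 / 4 : ℝ) • (Q * balancedFactor σ V) := by
  have hW2 := rpow_quarter_sq_mul_sqrt hlamW hlamH
  have hH2 := rpow_quarter_sq_mul_sqrt hlamH hlamW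
  have hinv : (lamH / lamW) ^ (1 / 4 : ℝ) = ((lamW / lamH) ^ (1 / 4 : ℝ))⁻¹ := by
    rw [← Real.inv_rpow (by positivity), inv_div]
  rw [hinv, mul_comm lamH] at hH2
  rw [hinv]
  set c := (lamW / lamH) ^ (1 / 4 : ℝ)
  have hc : c ≠ 0 := (Real.rpow_pos_of_pos (by positivity) _).ne'
  have hcard : Fintype.card (Fin K) ≤ Fintype.card (Fin d) := by simpa using hd
  obtain ⟨Q₀, hQ₀⟩ := exists_isometry hcard
  have hscale := isMinOn_factorizedObjective_smul_iff (n := n) (lamW := √(lamW * lamH))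
    (lamH := √(lamW * lamH)) (lamb := lamb) hc (W := W) (H := H) (b := b')
  rw [hW2, hH2] at hscale
  rw [← hscale, isMinOn_factorizedObjective_iff_isOptimalFactorization
    (Real.sqrt_pos.2 (mul_pos hlamW hlamH)) hlamb h ⟨_, _,
      (isOptimalFactorization_iff hcard hU hV hσ hZ).2 ⟨Q₀, hQ₀, rfl, rfl⟩⟩,
    isOptimalFactorization_iff hcard hU hV hσ hZ]
  simp only [eq_inv_smul_iff₀ hc, ← inv_smul_eq_iff₀ hc]

end FactorizedObjective

section Features

theorem balancedFactor_mul {ι κ ν : Type*} [Fintype ν] [DecidableEq ν] [Fintype ι] (σ : ν → ℝ)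
    (A : Matrix κ ι ℝ) (V : Matrix ι ν ℝ) :
    balancedFactor σ (A * V) = balancedFactor σ V * Aᵀ := by
  simp only [balancedFactor, transpose_mul, Matrix.mul_assoc]

theorem ClusterInvariant.gram_balancedFactor_left {ι ν α : Type*} [Fintype ι] [Fintype ν]
    [DecidableEq ν] {n : ι → α} {U V : Matrix ι ν ℝ} {σ : ν → ℝ} (hσ : ∀ i, 0 ≤ σ i)
    (hU : Uᵀ * U = 1) (hV : Vᵀ * V = 1) (hM : ClusterInvariant n (U * diagonal σ * Vᵀ)) :
    ClusterInvariant n ((balancedFactor σ U)ᵀ * balancedFactor σ U) := by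
  refine .of_mul_self (posSemidef_conjTranspose_mul_self (balancedFactor σ U)) ?_
  convert hM.mul hM.transpose using 1
  simp only [transpose_balancedFactor_mul hσ, transpose_mul, transpose_transpose,
    diagonal_transpose, Matrix.mul_assoc]
  rw [← Matrix.mul_assoc Uᵀ, hU, ← Matrix.mul_assoc Vᵀ, hV]

theorem ClusterInvariant.gram_balancedFactor_right {ι ν α : Type*} [Fintype ι] [Fintype ν]
    [DecidableEq ν] {n : ι → α} {U V : Matrix ι ν ℝ} {σ : ν → ℝ} (hσ : ∀ i, 0 ≤ σ i)
    (hU : Uᵀ * U = 1) (hV : Vᵀ * V = 1) (hM : ClusterInvariant n (U * diagonal σ * Vᵀ)) :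
    ClusterInvariant n ((balancedFactor σ V)ᵀ * balancedFactor σ V) := by
  refine .gram_balancedFactor_left hσ hV hU ?_
  simpa only [transpose_mul, transpose_transpose, diagonal_transpose, Matrix.mul_assoc] using
    hM.transpose

theorem ClusterInvariant.gram_mul_diagonal_comp {ι μ α : Type*} [Fintype ι] [DecidableEq ι]
    [Fintype μ] {n : ι → α} {M : Matrix μ ι ℝ} (hM : ClusterInvariant n (Mᵀ * M)) (f : α → ℝ) :
    ClusterInvariant n ((M * diagonal (f ∘ n))ᵀ * (M * diagonal (f ∘ n))) := by
  have hf := ClusterInvariant.diagonal_comp n f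
  simpa only [transpose_mul, diagonal_transpose, Matrix.mul_assoc] using (hf.mul hM).mul hf

theorem balancedFactor_mul_labels {K : ℕ} {n : Fin K → ℕ} {ν : Type*} [Fintype ν]
    [DecidableEq ν] (σ : ν → ℝ) (V : Matrix (Fin K) ν ℝ) :
    balancedFactor σ V * diagonal (fun k => (√(n k : ℝ))⁻¹) * labels n =
      balancedFactor σ ((normalizedLabels n)ᵀ * V) := by
  rw [balancedFactor_mul, transpose_transpose, Matrix.mul_assoc, normalizedLabels]

theorem eq_transpose_balancedFactor_mul {ι ν : Type*} [Fintype ν] [DecidableEq ν] {K : ℕ}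
    {n : Fin K → ℕ} (hn : ∀ k, 0 < n k) {M : Matrix ι (Fin K) ℝ} {U : Matrix ι ν ℝ}
    {V : Matrix (Fin K) ν ℝ} {σ : ν → ℝ} (hσ : ∀ i, 0 ≤ σ i)
    (hM : M * diagonal (fun k => √(n k : ℝ)) = U * diagonal σ * Vᵀ) :
    M = (balancedFactor σ U)ᵀ * (balancedFactor σ V * diagonal fun k => (√(n k : ℝ))⁻¹) := by
  rw [← Matrix.mul_assoc, transpose_balancedFactor_mul hσ, ← hM, Matrix.mul_assoc,
    diagonal_sqrt_mul_diagonal_inv hn, Matrix.mul_one]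

end Features

end UFM

open Matrix UFM in
theorem mainTheorem1 {K : ℕ} (hK : 0 < K) (n : Fin K → ℕ) (hn : ∀ k, 0 < n k)
    (lamZ lamb : ℝ) (hlamZ : 0 < lamZ) (hlamb : 0 < lamb) :
    -- existence and uniqueness of the global minimizer
    (∃! p : Matrix (Fin K) (Sample n) ℝ × (Fin K → ℝ),
      IsMinOn (convexObjective n lamZ lamb) Set.univ p) ∧
    ∀ (Z : Matrix (Fin K) (Sample n) ℝ) (b : Fin K → ℝ),
      IsMinOn (convexObjective n lamZ lamb) Set.univ (Z, b) →
      -- (a) within-class collapse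
      ((∀ k (i : Fin (n k)) l, Z l ⟨k, i⟩ = classMean n Z l k) ∧
        (∀ k, ∑ l, classMean n Z l k = 0) ∧
        Z = classMean n Z * labels n) ∧
      -- (b) block structure over the clusters
      ((∀ (J : ℕ) (Ns : Fin J → ℕ), Function.Injective Ns → Set.range Ns = Set.range n →
          ∃ (a : Fin J → ℝ) (A : Fin J → Fin J → ℝ) (c : Fin J → ℝ),
            classMean n Z = blockMatrix n Ns a A ∧
            b = ∑ j, c j • indVec (cluster n (Ns j)) ∧
            ∀ j, a j + ∑ j', A j' j * ((cluster n (Ns j')).card : ℝ) = 0) ∧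
        EqualAngles n (classMean n Z)) ∧
      -- (c) the balanced case
      ((∀ k l, n k = n l) →
        b = 0 ∧
        ∃ a : ℝ,
          classMean n Z = a • ((K : ℝ) • (1 : Matrix (Fin K) (Fin K) ℝ) - Matrix.of fun _ _ => 1) ∧
          (Real.sqrt (total n / K) ≤ total n * lamZ → a = 0) ∧
          (total n * lamZ < Real.sqrt (total n / K) →
            a = 1 / K * Real.log (Real.sqrt K / (Real.sqrt (total n) * lamZ) - K + 1))) ∧
      -- (d) weights and features from any singular value decomposition `U Σ Vᵀ` of `Z̄ D^{1/2}`
      (∀ U ∈ Matrix.orthogonalGroup (Fin K) ℝ, ∀ V ∈ Matrix.orthogonalGroup (Fin K) ℝ,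
        ∀ σ : Fin K → ℝ, (∀ k, 0 ≤ σ k) →
        classMean n Z * Matrix.diagonal (fun k => Real.sqrt (n k)) =
          U * Matrix.diagonal σ * Vᵀ →
        ∀ W Hbar : Matrix (Fin K) (Fin K) ℝ,
        W = Matrix.diagonal (fun k => Real.sqrt (σ k)) * Uᵀ →
        Hbar = Matrix.diagonal (fun k => Real.sqrt (σ k)) * Vᵀ *
          Matrix.diagonal (fun k => (Real.sqrt (n k))⁻¹) →
        classMean n Z = Wᵀ * Hbar ∧
        Z = Wᵀ * (Hbar * labels n) ∧
        -- block structure of the Gram matrices, and equal angles of the mean features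
        (∀ (J : ℕ) (Ns : Fin J → ℕ), Function.Injective Ns → Set.range Ns = Set.range n →
          (∃ (a : Fin J → ℝ) (A : Fin J → Fin J → ℝ), Wᵀ * W = blockMatrix n Ns a A) ∧
          (∃ (a : Fin J → ℝ) (A : Fin J → Fin J → ℝ), Hbarᵀ * Hbar = blockMatrix n Ns a A)) ∧
        EqualAngles n Hbar ∧
        -- up to the scaling between `lamW` and `lamH` and an isometry of the feature space, these
        -- are exactly the global minimizers of the factorized model
        ∀ lamW lamH : ℝ, 0 < lamW → 0 < lamH → Real.sqrt (lamW * lamH) = lamZ →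
          ∀ d : ℕ, K ≤ d →
          ∀ (W' : Matrix (Fin d) (Fin K) ℝ) (H' : Matrix (Fin d) (Sample n) ℝ) (b' : Fin K → ℝ),
            IsMinOn (factorizedObjective n lamW lamH lamb d) Set.univ (W', H', b') ↔
              b' = b ∧ ∃ Q : Matrix (Fin d) (Fin K) ℝ, Qᵀ * Q = 1 ∧
                W' = (lamH / lamW) ^ (1 / 4 : ℝ) • (Q * W) ∧
                H' = (lamW / lamH) ^ (1 / 4 : ℝ) • (Q * (Hbar * labels n))) := by
  refine ⟨existsUnique_isMinOn_convexObjective n hlamZ hlamb, fun Z b h => ?_⟩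
  have hZ := eq_classMean_mul_labels_of_isMinOn hlamZ hlamb h
  have hsum := sum_classMean_eq_zero (sum_eq_zero_of_isMinOn_convexObjective hlamZ h)
  have hinv := clusterInvariant_classMean_of_isMinOn hlamZ hlamb h
  refine ⟨⟨eq_classMean_of_isMinOn hlamZ hlamb h, hsum, hZ⟩, ⟨fun J Ns hNs hrange => ?_,
    equalAngles_of_clusterInvariant (hinv.transpose.mul hinv)⟩, fun hbal => ?_, ?_⟩
  · obtain ⟨a, A, hA⟩ := hinv.exists_eq_blockMatrix hNs hrange
    obtain ⟨c, hc⟩ := exists_eq_sum_smul_indVec (factorsThrough_of_isMinOn hlamZ hlamb h) hNs hrange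
    exact ⟨a, A, c, hA, hc, add_sum_mul_card_cluster_eq_zero (hA ▸ hsum) hNs hrange⟩
  · obtain ⟨hb, hmean⟩ := classMean_eq_of_isMinOn_of_balanced hlamZ hlamb (hn ⟨0, hK⟩)
      (fun k => hbal k _) h
    exact ⟨hb, _, hmean, fun hle => if_pos hle, fun hlt => if_neg hlt.not_ge⟩
  · rintro U hU V hV σ hσ hsvd W Hbar rfl rfl
    rw [mem_orthogonalGroup_iff'] at hU hV
    have hmean := eq_transpose_balancedFactor_mul hn hσ hsvd
    have hinvσ := hsvd ▸ hinv.mul (.diagonal_comp n fun m => √m)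
    have hinvW := hinvσ.gram_balancedFactor_left hσ hU hV
    have hinvH := (hinvσ.gram_balancedFactor_right hσ hU hV).gram_mul_diagonal_comp fun m => (√m)⁻¹
    rw [hmean, Matrix.mul_assoc] at hZ
    refine ⟨hmean, hZ, fun J Ns hNs hrange => ⟨hinvW.exists_eq_blockMatrix hNs hrange,
      hinvH.exists_eq_blockMatrix hNs hrange⟩, equalAngles_of_clusterInvariant hinvH, ?_⟩
    rintro lamW lamH hlamW hlamH rfl d hd W' H' b'
    have hfeatures := balancedFactor_mul_labels (n := n) σ V
    rw [hfeatures, transpose_balancedFactor_mul hσ] at hZ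
    have hE := (transpose_mul_isometry_mul (normalizedLabels_mul_transpose hn) V V).trans hV
    exact hfeatures ▸ isMinOn_factorizedObjective_iff hlamb hlamW hlamH h hd hU hE hσ hZ
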